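/- **Setting.** Let $d,m\ge 1$ and let $T_1,\dots,T_m$ be invertible real $d\times d$ matrices with $\|T_i\|<1$ for all $i$, where $\|\cdot\|$ is the operator norm for the Euclidean norm on $\mathbb R^d$. Let $\Sigma=\{1,\dots,m\}^{\mathbb N}$ with the product topology. For $\mathbf a=(a_1,\dots,a_m)\in\mathbb R^{md}$ put $f_i^{\mathbf a}(v)=T_iv+a_i$ and let $$\pi^{\mathbf a}(x)=\lim_{n\to\infty} f^{\mathbf a}_{x_1}\circ\cdots\circ f^{\mathbf a}_{x_n}(0)\qquad (x=(x_i)_{i\ge1}\in\Sigma)$$ be the coding map. For a Borel probability measure $\mu$ on $\Sigma$ let $\pi^{\mathbf a}_*\mu=\mu\circ(\pi^{\mathbf a})^{-1}$. For a Borel probability measure $\eta$ on $\mathbb R^d$, with $B(z,r)$ the closed ball, put $$\underline{\dim}_{\rm loc}(\eta,z)=\liminf_{r\to0}\frac{\log\eta(B(z,r))}{\log r},\qquad \overline{\dim}_{\rm loc}(\eta,z)=\limsup_{r\to0}\frac{\log\eta(B(z,r))}{\log r}.$$ The lower and upper Hausdorff dimensions $\underline{\dim}_{\rm H}\eta$,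 $\overline{\dim}_{\rm H}\eta$ are the $\eta$-essential infimum and supremum of $z\mapsto\underline{\dim}_{\rm loc}(\eta,z)$; the lower and upper packing dimensions $\underline{\dim}_{\rm P}\eta$, $\overline{\dim}_{\rm P}\eta$ are the $\eta$-essential infimum and supremum of $z\mapsto\overline{\dim}_{\rm loc}(\eta,z)$. For an invertible $d\times d$ matrix $T$ with singular values $\alpha_1(T)\ge\dots\ge\alpha_d(T)$ put $$\phi^s(T)=\begin{cases}\alpha_1(T)\cdots\alpha_k(T)\,\alpha_{k+1}(T)^{s-k}, & 0\le s<d,\ k=\lfloor s\rfloor,\\ |\det T|^{s/d}, & d\le s<\infty,\end{cases}\qquad \phi^\infty(T)=0.$$ For $x\in\Sigma$ and $n\ge0$ let $T_{x|n}=T_{x_1}\cdots T_{x_n}$ (the identity if $n=0$) and $[x_1\cdots x_n]=\{y\in\Sigma: y_i=x_i \text{ for } 1\le i\le n\}$. For $n\ge1$ let $S_n(\mu,x)$ be the unique $t\in[0,\infty]$ with $\phi^t(T_{x|n})=\mu([x_1\cdots x_n])$, and let $S(\mu,x)=\liminf_{n\to\infty}S_n(\mu,x)$. Let $\underline S(\mu)$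 and $\overline S(\mu)$ be the $\mu$-essential infimum and supremum of $S(\mu,\cdot)$. For $x\ne y$ in $\Sigma$ let $x\wedge y$ be their longest common initial segment, $T_{x\wedge y}$ the corresponding product, and for $r>0$ $$Z_{x\wedge y}(r)=\prod_{k=1}^d\frac{\min\{r,\alpha_k(T_{x\wedge y})\}}{\alpha_k(T_{x\wedge y})};$$ put $Z_{x\wedge x}(r)=1$. Let $$G_\mu(x,r)=\int_\Sigma Z_{x\wedge y}(r)\,d\mu(y),\qquad D(\mu,x)=\limsup_{r\to0}\frac{\log G_\mu(x,r)}{\log r},$$ and let $\underline D(\mu)$ and $\overline D(\mu)$ be the $\mu$-essential infimum and supremum of $D(\mu,\cdot)$. **Theorem.** Let $\mu$ be a Borel probability measure on $\Sigma$. (i) For every $\mathbf a\in\mathbb R^{md}$, $$\underline{\dim}_{\rm loc}(\pi^{\mathbf a}_*\mu,\pi^{\mathbf a}x)\le\min\{S(\mu,x),d\}\quad\text{and}\quad \overline{\dim}_{\rm loc}(\pi^{\mathbf a}_*\mu,\pi^{\mathbf a}x)\le D(\mu,x)\quad\text{for }\mu\text{-a.e. }x\in\Sigma,$$ and consequently $\underline{\dim}_{\rm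 H}\pi^{\mathbf a}_*\mu\le\min\{\underline S(\mu),d\}$, $\overline{\dim}_{\rm H}\pi^{\mathbf a}_*\mu\le\min\{\overline S(\mu),d\}$, $\underline{\dim}_{\rm P}\pi^{\mathbf a}_*\mu\le\underline D(\mu)$ and $\overline{\dim}_{\rm P}\pi^{\mathbf a}_*\mu\le\overline D(\mu)$. (ii) Assume that $\|T_i\|<1/2$ for $1\le i\le m$. Then for Lebesgue-a.e. $\mathbf a\in\mathbb R^{md}$, $$\underline{\dim}_{\rm loc}(\pi^{\mathbf a}_*\mu,\pi^{\mathbf a}x)=\min\{S(\mu,x),d\}\quad\text{and}\quad \overline{\dim}_{\rm loc}(\pi^{\mathbf a}_*\mu,\pi^{\mathbf a}x)=D(\mu,x)\quad\text{for }\mu\text{-a.e. }x\in\Sigma,$$ and consequently, for Lebesgue-a.e. $\mathbf a\in\mathbb R^{md}$, $\underline{\dim}_{\rm H}\pi^{\mathbf a}_*\mu=\min\{\underline S(\mu),d\}$, $\overline{\dim}_{\rm H}\pi^{\mathbf a}_*\mu=\min\{\overline S(\mu),d\}$, $\underline{\dim}_{\rm P}\pi^{\mathbf a}_*\mu=\underline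 D(\mu)$ and $\overline{\dim}_{\rm P}\pi^{\mathbf a}_*\mu=\overline D(\mu)$. -/

import Mathlib

open MeasureTheory Filter Topology
open scoped ENNReal

noncomputable section

/-- The space `ℝ^d` with its Euclidean norm and Lebesgue measure. -/
abbrev Euc (d : ℕ) : Type := EuclideanSpace ℝ (Fin d)

/-- The symbolic space `Σ = {1, …, m}^ℕ`, with the product topology and its Borel σ-algebra.
Sequences are indexed from `0`. -/
abbrev Shift (m : ℕ) : Type := ℕ → Fin m

/-! ### Singular values and the singular value function -/

/-- The operator norm of a matrix with respect to the Euclidean norm. -/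
def opNorm {d : ℕ} (A : Matrix (Fin d) (Fin d) ℝ) : ℝ :=
  ‖Matrix.toEuclideanCLM (n := Fin d) (𝕜 := ℝ) A‖

/-- The singular values of `A` in decreasing order, with multiplicity, indexed from `0`: the usual
`α_k(A)` is `singVal A (k - 1)`. -/
def singVal {d : ℕ} (A : Matrix (Fin d) (Fin d) ℝ) (k : ℕ) : ℝ :=
  (Matrix.toEuclideanLin A).singularValues k

/-- The singular value function `φ^s(A)` for real `s ≥ 0`. -/
def svf {d : ℕ} (s : ℝ) (A : Matrix (Fin d) (Fin d) ℝ) : ℝ :=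
  if s < d then
    (∏ i ∈ Finset.range ⌊s⌋₊, singVal A i) * singVal A ⌊s⌋₊ ^ (s - (⌊s⌋₊ : ℝ))
  else |A.det| ^ (s / (d : ℝ))

/-- The singular value function for `s ∈ [0, ∞]`, with `φ^∞ = 0`. -/
def svfExt {d : ℕ} (s : ℝ≥0∞) (A : Matrix (Fin d) (Fin d) ℝ) : ℝ :=
  if s = ∞ then 0 else svf s.toReal A

/-! ### Words, the iterated function system and the coding map -/

/-- The product `T_{x|n} = T_{x_1} ⋯ T_{x_n}` along the first `n` symbols of `x`
(the identity for `n = 0`). -/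
def prefixProd {m d : ℕ} (T : Fin m → Matrix (Fin d) (Fin d) ℝ) (x : Shift m) :
    ℕ → Matrix (Fin d) (Fin d) ℝ
  | 0 => 1
  | n + 1 => prefixProd T x n * T (x n)

/-- The affine map `f_i^a(v) = T_i v + a_i`. -/
def ifsMap {m d : ℕ} (T : Fin m → Matrix (Fin d) (Fin d) ℝ) (a : Fin m → Euc d) (i : Fin m)
    (v : Euc d) : Euc d :=
  Matrix.toEuclideanCLM (n := Fin d) (𝕜 := ℝ) (T i) v + a i

/-- The composition `f_{x_1}^a ∘ ⋯ ∘ f_{x_n}^a`. -/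
def ifsComp {m d : ℕ} (T : Fin m → Matrix (Fin d) (Fin d) ℝ) (a : Fin m → Euc d) (x : Shift m) :
    ℕ → Euc d → Euc d
  | 0 => id
  | n + 1 => ifsComp T a x n ∘ ifsMap T a (x n)

/-- The coding map `π^a(x) = lim_{n → ∞} f_{x_1}^a ∘ ⋯ ∘ f_{x_n}^a (0)`. -/
def codingMap {m d : ℕ} (T : Fin m → Matrix (Fin d) (Fin d) ℝ) (a : Fin m → Euc d)
    (x : Shift m) : Euc d :=
  limUnder atTop (fun n : ℕ => ifsComp T a x n 0)

/-- The projection `π^a_* μ`. -/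
def projMeasure {m d : ℕ} (T : Fin m → Matrix (Fin d) (Fin d) ℝ) (a : Fin m → Euc d)
    (μ : Measure (Shift m)) : Measure (Euc d) :=
  μ.map (codingMap T a)

/-! ### Local dimensions and dimensions of measures

Here `ENNReal.log 0 = ⊥`, so the quotient is `⊤` if the ball is null and `0 < r < 1`. -/

/-- The lower local dimension `liminf_{r → 0} log η(B(x,r)) / log r`, with closed balls. -/
def lowerLocDim {X : Type*} [PseudoMetricSpace X] [MeasurableSpace X] (η : Measure X) (x : X) :
    EReal :=
  liminf (fun r : ℝ => ENNReal.log (η (Metric.closedBall x r)) / (Real.log r : EReal)) (𝓝[>] 0)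

/-- The upper local dimension `limsup_{r → 0} log η(B(x,r)) / log r`, with closed balls. -/
def upperLocDim {X : Type*} [PseudoMetricSpace X] [MeasurableSpace X] (η : Measure X) (x : X) :
    EReal :=
  limsup (fun r : ℝ => ENNReal.log (η (Metric.closedBall x r)) / (Real.log r : EReal)) (𝓝[>] 0)

/-- The lower Hausdorff dimension of a measure. -/
def lowerHausdorffDim {X : Type*} [PseudoMetricSpace X] [MeasurableSpace X] (η : Measure X) :
    EReal :=
  essInf (lowerLocDim η) η

/-- The upper Hausdorff dimension of a measure. -/
def upperHausdorffDim {X : Type*} [PseudoMetricSpace X] [MeasurableSpace X] (η : Measure X) :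
    EReal :=
  essSup (lowerLocDim η) η

/-- The lower packing dimension of a measure. -/
def lowerPackingDim {X : Type*} [PseudoMetricSpace X] [MeasurableSpace X] (η : Measure X) :
    EReal :=
  essInf (upperLocDim η) η

/-- The upper packing dimension of a measure. -/
def upperPackingDim {X : Type*} [PseudoMetricSpace X] [MeasurableSpace X] (η : Measure X) :
    EReal :=
  essSup (upperLocDim η) η

/-! ### The quantities `S(μ,x)` and `D(μ,x)` -/

/-- `S_n(μ,x)`: for `n ≥ 1` the unique `t ∈ [0,∞]` with `φ^t(T_{x|n}) = μ([x_1 ⋯ x_n])`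
(existence and uniqueness are `existsUnique_svfExt_prefixProd` below). -/
def Sn {m d : ℕ} (T : Fin m → Matrix (Fin d) (Fin d) ℝ) (μ : Measure (Shift m)) (x : Shift m)
    (n : ℕ) : ℝ≥0∞ :=
  sInf {t : ℝ≥0∞ | svfExt t (prefixProd T x n) = μ.real (PiNat.cylinder x n)}

/-- `S(μ,x) = liminf_{n → ∞} S_n(μ,x)`. -/
def Sloc {m d : ℕ} (T : Fin m → Matrix (Fin d) (Fin d) ℝ) (μ : Measure (Shift m))
    (x : Shift m) : ℝ≥0∞ :=
  liminf (fun n : ℕ => Sn T μ x n) atTop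

/-- The `μ`-essential infimum of `S(μ,·)`. -/
def Slower {m d : ℕ} (T : Fin m → Matrix (Fin d) (Fin d) ℝ) (μ : Measure (Shift m)) : ℝ≥0∞ :=
  essInf (Sloc T μ) μ

/-- The `μ`-essential supremum of `S(μ,·)`. -/
def Supper {m d : ℕ} (T : Fin m → Matrix (Fin d) (Fin d) ℝ) (μ : Measure (Shift m)) : ℝ≥0∞ :=
  essSup (Sloc T μ) μ

open Classical in
/-- `Z_{x ∧ y}(r)`. For `x ≠ y` the common initial segment `x ∧ y` is the prefix of `x` of length
`PiNat.firstDiff x y`, the first (`0`-based) index at which `x` and `y` differ. -/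
def Zfun {m d : ℕ} (T : Fin m → Matrix (Fin d) (Fin d) ℝ) (x y : Shift m) (r : ℝ) : ℝ :=
  if x = y then 1
  else ∏ k ∈ Finset.range d,
    min r (singVal (prefixProd T x (PiNat.firstDiff x y)) k) /
      singVal (prefixProd T x (PiNat.firstDiff x y)) k

/-- `G_μ(x,r) = ∫ Z_{x ∧ y}(r) dμ(y)`; the integrand takes values in `(0,1]`. -/
def Gfun {m d : ℕ} (T : Fin m → Matrix (Fin d) (Fin d) ℝ) (μ : Measure (Shift m)) (x : Shift m)
    (r : ℝ) : ℝ≥0∞ :=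
  ∫⁻ y, ENNReal.ofReal (Zfun T x y r) ∂μ

/-- `D(μ,x) = limsup_{r → 0} log G_μ(x,r) / log r`. -/
def Dloc {m d : ℕ} (T : Fin m → Matrix (Fin d) (Fin d) ℝ) (μ : Measure (Shift m))
    (x : Shift m) : EReal :=
  limsup (fun r : ℝ => ENNReal.log (Gfun T μ x r) / (Real.log r : EReal)) (𝓝[>] 0)

/-- The `μ`-essential infimum of `D(μ,·)`. -/
def Dlower {m d : ℕ} (T : Fin m → Matrix (Fin d) (Fin d) ℝ) (μ : Measure (Shift m)) : EReal :=
  essInf (Dloc T μ) μ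

/-- The `μ`-essential supremum of `D(μ,·)`. -/
def Dupper {m d : ℕ} (T : Fin m → Matrix (Fin d) (Fin d) ℝ) (μ : Measure (Shift m)) : EReal :=
  essSup (Dloc T μ) μ

/-! Existence and uniqueness of the number defining `S_n(μ,x)`. -/

theorem prod_singVal {d : ℕ} (A : Matrix (Fin d) (Fin d) ℝ) :
    ∏ i ∈ Finset.range d, singVal A i = |A.det| := by
  have h := LinearMap.normDet_eq_prod_singularValues (Matrix.toEuclideanLin A)
  rw [LinearMap.normDet_eq_abs_det, finrank_euclideanSpace, Fintype.card_fin] at h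
  have h2 : LinearMap.det (Matrix.toEuclideanLin A) = A.det := by
    change LinearMap.det (Matrix.toLpLin 2 2 A) = A.det
    rw [Matrix.toLpLin_eq_toLin, LinearMap.det_toLin]
  rw [h2] at h
  exact h.symm

theorem singVal_pos {d : ℕ} {A : Matrix (Fin d) (Fin d) ℝ} (hA : A.det ≠ 0) {i : ℕ}
    (hi : i < d) : 0 < singVal A i := by
  refine lt_of_le_of_ne (LinearMap.singularValues_nonneg _ _) fun h => hA ?_
  rw [← abs_eq_zero, ← prod_singVal]
  exact Finset.prod_eq_zero (Finset.mem_range.2 hi) h.symm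

theorem singVal_le_opNorm {d : ℕ} (A : Matrix (Fin d) (Fin d) ℝ) {i : ℕ} (hi : i < d) :
    singVal A i ≤ opNorm A := by
  have hi' : i < Module.finrank ℝ (EuclideanSpace ℝ (Fin d)) := by simpa using hi
  obtain ⟨v, hv⟩ := ((Matrix.toEuclideanLin A).hasEigenvalue_adjoint_comp_self_sq_singularValues
    hi').exists_hasEigenvector
  have h1 := hv.apply_eq_smul
  have hv0 : 0 < ‖v‖ := norm_pos_iff.2 hv.2
  have h2 : ‖Matrix.toEuclideanLin A v‖ ^ 2 = singVal A i ^ 2 * ‖v‖ ^ 2 := by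
    have h3 : inner ℝ ((LinearMap.adjoint (Matrix.toEuclideanLin A) ∘ₗ
        Matrix.toEuclideanLin A) v) v = singVal A i ^ 2 * ‖v‖ ^ 2 := by
      rw [h1]
      simp [inner_smul_left, singVal]
    rw [← h3, LinearMap.comp_apply, LinearMap.adjoint_inner_left, real_inner_self_eq_norm_sq]
  have h4 : ‖Matrix.toEuclideanLin A v‖ ≤ opNorm A * ‖v‖ := by
    rw [← Matrix.coe_toEuclideanCLM_eq_toEuclideanLin]
    exact (Matrix.toEuclideanCLM (n := Fin d) (𝕜 := ℝ) A).le_opNorm v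
  have h5 : singVal A i * ‖v‖ ≤ opNorm A * ‖v‖ := by
    refine le_trans (le_of_eq ?_) h4
    rw [← mul_pow] at h2
    exact ((sq_eq_sq₀ (norm_nonneg _)
      (mul_nonneg (LinearMap.singularValues_nonneg _ _) hv0.le)).1 h2).symm
  exact le_of_mul_le_mul_right h5 hv0

/-- The logarithm of the singular value function, written as a single sum. -/
def logSvf {d : ℕ} (A : Matrix (Fin d) (Fin d) ℝ) (s : ℝ) : ℝ :=
  ∑ i ∈ Finset.range d, (min 1 (max 0 (s - i)) + max 0 ((s - d) / d)) * Real.log (singVal A i)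

theorem svf_eq_exp {d : ℕ} {A : Matrix (Fin d) (Fin d) ℝ} (hA : A.det ≠ 0) {s : ℝ}
    (hs : 0 ≤ s) : svf s A = Real.exp (logSvf A s) := by
  have key : ∀ c : ℕ → ℝ, Real.exp (∑ i ∈ Finset.range d, c i * Real.log (singVal A i)) =
      ∏ i ∈ Finset.range d, singVal A i ^ c i := by
    intro c
    rw [Real.exp_sum]
    refine Finset.prod_congr rfl fun i hi => ?_
    rw [Real.rpow_def_of_pos (singVal_pos hA (Finset.mem_range.1 hi)), mul_comm]
  rw [logSvf, key, svf]
  split_ifs with h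
  · have hd : (0 : ℝ) < d := lt_of_le_of_lt hs h
    have hk : ⌊s⌋₊ < d := (Nat.floor_lt hs).2 h
    have h0 : max 0 ((s - d) / d) = 0 :=
      max_eq_left (div_nonpos_of_nonpos_of_nonneg (by linarith) hd.le)
    have hf1 := Nat.floor_le hs
    have hf2 := Nat.lt_floor_add_one s
    rw [h0, ← Finset.prod_range_mul_prod_Ico _ (Nat.succ_le_of_lt hk), Finset.prod_range_succ]
    have e1 : ∀ i ∈ Finset.range ⌊s⌋₊,
        singVal A i ^ (min 1 (max 0 (s - i)) + 0) = singVal A i := by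
      intro i hi
      have : (i : ℝ) + 1 ≤ ⌊s⌋₊ := by exact_mod_cast Finset.mem_range.1 hi
      rw [max_eq_right (by linarith), min_eq_left (by linarith), add_zero, Real.rpow_one]
    have e2 : ∀ i ∈ Finset.Ico (⌊s⌋₊ + 1) d,
        singVal A i ^ (min 1 (max 0 (s - i)) + 0) = 1 := by
      intro i hi
      have : (⌊s⌋₊ : ℝ) + 1 ≤ i := by exact_mod_cast (Finset.mem_Ico.1 hi).1
      rw [max_eq_left (by linarith), min_eq_right (by linarith), add_zero, Real.rpow_zero]
    rw [Finset.prod_congr rfl e1, Finset.prod_congr rfl e2, Finset.prod_const_one, mul_one,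
      max_eq_right (by linarith : (0 : ℝ) ≤ s - ⌊s⌋₊), min_eq_right (by linarith), add_zero]
  · push Not at h
    rw [← prod_singVal,
      ← Real.finsetProd_rpow _ _ (fun i hi => (singVal_pos hA (Finset.mem_range.1 hi)).le)]
    refine Finset.prod_congr rfl fun i hi => ?_
    have hi' : (i : ℝ) + 1 ≤ d := by exact_mod_cast Finset.mem_range.1 hi
    have hd : (0 : ℝ) < d := by have := Nat.cast_nonneg (α := ℝ) i; linarith
    rw [max_eq_right (by linarith), min_eq_left (by linarith),
      max_eq_right (div_nonneg (by linarith) hd.le), sub_div, div_self hd.ne']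
    congr 1
    ring

theorem continuous_logSvf {d : ℕ} (A : Matrix (Fin d) (Fin d) ℝ) : Continuous (logSvf A) := by
  unfold logSvf
  fun_prop

theorem logSvf_strictAntiOn {d : ℕ} (hd : 0 < d) {A : Matrix (Fin d) (Fin d) ℝ}
    (hA : A.det ≠ 0) (hA1 : opNorm A < 1) : StrictAntiOn (logSvf A) (Set.Ici 0) := by
  intro s hs t _ hst
  have hs : 0 ≤ s := hs
  have hd' : (0 : ℝ) < d := by exact_mod_cast hd
  have hlog : ∀ i, i < d → Real.log (singVal A i) < 0 := fun i hi =>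
    Real.log_neg (singVal_pos hA hi) ((singVal_le_opNorm A hi).trans_lt hA1)
  have m1 : ∀ i : ℕ, min 1 (max 0 (s - i)) ≤ min 1 (max 0 (t - i)) := fun i =>
    min_le_min le_rfl (max_le_max le_rfl (by linarith))
  have m2 : max 0 ((s - d) / d) ≤ max 0 ((t - d) / d) :=
    max_le_max le_rfl (div_le_div_of_nonneg_right (by linarith) hd'.le)
  refine Finset.sum_lt_sum (fun i hi => mul_le_mul_of_nonpos_right (add_le_add (m1 i) m2)
    (hlog i (Finset.mem_range.1 hi)).le) ?_
  by_cases h : s < d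
  · have hk : ⌊s⌋₊ < d := (Nat.floor_lt hs).2 h
    have hf1 := Nat.floor_le hs
    have hf2 := Nat.lt_floor_add_one s
    refine ⟨⌊s⌋₊, Finset.mem_range.2 hk, mul_lt_mul_of_neg_right (add_lt_add_of_lt_of_le ?_ m2)
      (hlog _ hk)⟩
    rw [max_eq_right (by linarith), max_eq_right (by linarith), min_eq_right (by linarith)]
    exact lt_min (by linarith) (by linarith)
  · push Not at h
    refine ⟨0, Finset.mem_range.2 hd, mul_lt_mul_of_neg_right (add_lt_add_of_le_of_lt (m1 0) ?_)
      (hlog 0 hd)⟩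
    rw [max_eq_right (div_nonneg (by linarith) hd'.le),
      max_eq_right (div_nonneg (by linarith) hd'.le)]
    exact div_lt_div_of_pos_right (by linarith) hd'

theorem existsUnique_svfExt {d : ℕ} (hd : 0 < d) {A : Matrix (Fin d) (Fin d) ℝ}
    (hA : A.det ≠ 0) (hA1 : opNorm A < 1) {c : ℝ} (hc0 : 0 ≤ c) (hc1 : c ≤ 1) :
    ∃! t : ℝ≥0∞, svfExt t A = c := by
  have hd' : (0 : ℝ) < d := by exact_mod_cast hd
  have hval : ∀ t : ℝ≥0∞, t ≠ ∞ → svfExt t A = Real.exp (logSvf A t.toReal) := fun t ht => by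
    rw [svfExt, if_neg ht, svf_eq_exp hA ENNReal.toReal_nonneg]
  refine existsUnique_of_exists_of_unique ?_ ?_
  · rcases hc0.eq_or_lt with rfl | hc
    · exact ⟨∞, if_pos rfl⟩
    have hdet : 0 < |A.det| := abs_pos.2 hA
    have hdet1 : Real.log |A.det| < 0 := by
      rw [← prod_singVal, Real.log_prod fun i hi => (singVal_pos hA (Finset.mem_range.1 hi)).ne']
      exact Finset.sum_neg (fun i hi => Real.log_neg (singVal_pos hA (Finset.mem_range.1 hi))
        ((singVal_le_opNorm A (Finset.mem_range.1 hi)).trans_lt hA1)) ⟨0, Finset.mem_range.2 hd⟩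
    have h0 : logSvf A 0 = 0 := by
      rw [← Real.exp_eq_one_iff, ← svf_eq_exp hA le_rfl]
      simp [svf, hd]
    obtain ⟨N, hN1, hN2⟩ : ∃ N : ℝ, (d : ℝ) ≤ N ∧ logSvf A N ≤ Real.log c := by
      refine ⟨max d (d * (Real.log c / Real.log |A.det|)), le_max_left _ _, ?_⟩
      set N := max (d : ℝ) (d * (Real.log c / Real.log |A.det|))
      have hN : (d : ℝ) ≤ N := le_max_left _ _
      have hN' : Real.log c / Real.log |A.det| ≤ N / d := by
        rw [le_div_iff₀ hd', mul_comm]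
        exact le_max_right _ _
      have e := svf_eq_exp hA (hd'.le.trans hN)
      rw [svf, if_neg (not_lt.2 hN)] at e
      have e2 := congrArg Real.log e
      rw [Real.log_exp, Real.log_rpow hdet] at e2
      rw [← e2]
      calc N / d * Real.log |A.det| ≤ Real.log c / Real.log |A.det| * Real.log |A.det| :=
            mul_le_mul_of_nonpos_right hN' hdet1.le
        _ = Real.log c := div_mul_cancel₀ _ hdet1.ne
    obtain ⟨t, ht, hte⟩ := intermediate_value_Icc' (hd'.le.trans hN1)
      (continuous_logSvf A).continuousOn
      (show Real.log c ∈ Set.Icc (logSvf A N) (logSvf A 0) from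
        ⟨hN2, h0.symm ▸ Real.log_nonpos hc0 hc1⟩)
    refine ⟨ENNReal.ofReal t, ?_⟩
    rw [hval _ ENNReal.ofReal_ne_top, ENNReal.toReal_ofReal ht.1, hte, Real.exp_log hc]
  · intro s t hs ht
    by_cases h1 : s = ∞ <;> by_cases h2 : t = ∞
    · rw [h1, h2]
    · rw [← ht, hval t h2, svfExt, if_pos h1] at hs
      exact absurd hs (Real.exp_pos _).ne
    · rw [← hs, hval s h1, svfExt, if_pos h2] at ht
      exact absurd ht (Real.exp_pos _).ne
    · rw [← ht, hval s h1, hval t h2, Real.exp_eq_exp] at hs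
      exact (ENNReal.toReal_eq_toReal_iff' h1 h2).1
        ((logSvf_strictAntiOn hd hA hA1).injOn ENNReal.toReal_nonneg ENNReal.toReal_nonneg hs)

theorem opNorm_mul_le {d : ℕ} (A B : Matrix (Fin d) (Fin d) ℝ) :
    opNorm (A * B) ≤ opNorm A * opNorm B := by
  unfold opNorm
  rw [map_mul]
  exact norm_mul_le _ _

theorem existsUnique_svfExt_prefixProd {m d : ℕ} (hd : 0 < d)
    (T : Fin m → Matrix (Fin d) (Fin d) ℝ) (hT : ∀ i, (T i).det ≠ 0)
    (hT1 : ∀ i, opNorm (T i) < 1) (μ : Measure (Shift m)) [IsProbabilityMeasure μ]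
    (x : Shift m) {n : ℕ} (hn : 0 < n) :
    ∃! t : ℝ≥0∞, svfExt t (prefixProd T x n) = μ.real (PiNat.cylinder x n) := by
  refine existsUnique_svfExt hd ?_ ?_ measureReal_nonneg measureReal_le_one
  · clear hn
    induction n with
    | zero => simp [prefixProd]
    | succ n ih => rw [prefixProd, Matrix.det_mul]; exact mul_ne_zero ih (hT _)
  · have h1 : ∀ k, opNorm (prefixProd T x k) ≤ 1 := by
      intro k
      induction k with
      | zero =>
        simp only [prefixProd, opNorm, map_one]
        exact ContinuousLinearMap.norm_id_le
      | succ k ih =>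
        exact (opNorm_mul_le _ _).trans (mul_le_one₀ ih (norm_nonneg _) (hT1 _).le)
    obtain ⟨k, rfl⟩ : ∃ k, n = k + 1 := ⟨n - 1, by omega⟩
    exact (opNorm_mul_le _ _).trans_lt
      ((mul_le_of_le_one_left (norm_nonneg _) (h1 k)).trans_lt (hT1 _))

end

/-!
Every local dimension is the scaling exponent of a mass function of `r`, and such exponents are
unaffected by subexponential factors. Write `u ≼ v` if `u r ≤ r ^ (-ε) * v r` for every `ε > 0` and
all small `r`, and let `W μ x r` be the supremum over `n` of `∏ₖ min (1, r / αₖ(T_{x|n}))` times the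
mass of `[x|n]`. Then

`G_μ(x, r) ≼ W μ x r ≼ π^a_* μ (B(π^a x, r)) ≼ G_μ(x, r)`.

The first relation holds because only the first `O(log 1/r)` cylinders around `x` matter. For the
second, `π^a [x|n]` is covered by about `∏ₖ max (1, αₖ / r)` cells of diameter at most `r`, and the
points in cells of too little mass are negligible by Borel–Cantelli. The third uses
`‖T_i‖ < 1 / 2`: if `x` and `y` first differ at place `n`, then for some letter `i` the difference
`π^a x - π^a y` is the image under `T_{x|n}` of an affine function of `a_i` whose linear part is
bounded below, so that its norm is at most `r` only on a set of `a` of measure `O(Z_{x∧y}(r))`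
within a bounded region. Finally, the lower scaling exponent of `W μ x` is `min {S(μ, x), d}`.
-/

/-! ### Scaling exponents -/

/-- The exponent `t` for which `u = r ^ t`, in the extended sense of the local dimensions: it is `⊤`
for `u = 0` and `0 < r < 1`. -/
noncomputable def logRatio (r : ℝ) (u : ℝ≥0∞) : EReal :=
  ENNReal.log u / (Real.log r : EReal)

/-- The lower scaling exponent of `g` at `0`; the lower local dimension of `η` at `z` is that of
`r ↦ η(B(z,r))`. -/
noncomputable def lowerExp (g : ℝ → ℝ≥0∞) : EReal :=
  liminf (fun r => logRatio r (g r)) (𝓝[>] 0)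

/-- The upper scaling exponent of `g` at `0`; the upper local dimension of `η` at `z` is that of
`r ↦ η(B(z,r))`, and `D(μ,x)` is that of `G_μ(x,·)`. -/
noncomputable def upperExp (g : ℝ → ℝ≥0∞) : EReal :=
  limsup (fun r => logRatio r (g r)) (𝓝[>] 0)

section LogRatio

variable {r : ℝ} {u : ℝ≥0∞} {t : ℝ}

theorem logRatio_ofReal_rpow (h0 : 0 < r) (h1 : r < 1) (t : ℝ) :
    logRatio r (ENNReal.ofReal (r ^ t)) = t := by
  rw [logRatio, ENNReal.log_ofReal_of_pos (Real.rpow_pos_of_pos h0 _), Real.log_rpow h0,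
    ← EReal.coe_div, mul_div_cancel_right₀ _ (Real.log_neg h0 h1).ne]

theorem logRatio_le_logRatio_iff (h0 : 0 < r) (h1 : r < 1) {u v : ℝ≥0∞} :
    logRatio r u ≤ logRatio r v ↔ v ≤ u := by
  have hlog : (Real.log r : EReal) < 0 := by exact_mod_cast Real.log_neg h0 h1
  rw [logRatio, logRatio,
    (EReal.strictAnti_div_right_of_neg hlog (EReal.coe_ne_bot _)).le_iff_ge,
    ENNReal.log_le_log_iff]

theorem logRatio_le_iff (h0 : 0 < r) (h1 : r < 1) :
    logRatio r u ≤ t ↔ ENNReal.ofReal (r ^ t) ≤ u := by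
  rw [← logRatio_ofReal_rpow h0 h1 t, logRatio_le_logRatio_iff h0 h1]

theorem le_logRatio_iff (h0 : 0 < r) (h1 : r < 1) :
    t ≤ logRatio r u ↔ u ≤ ENNReal.ofReal (r ^ t) := by
  rw [← logRatio_ofReal_rpow h0 h1 t, logRatio_le_logRatio_iff h0 h1]

theorem measurable_logRatio (h0 : 0 ≤ r) (h1 : r ≤ 1) : Measurable (logRatio r) := by
  have hlog : (Real.log r : EReal) ≤ 0 := by exact_mod_cast Real.log_nonpos h0 h1
  exact (EReal.antitone_div_right_of_nonpos hlog).measurable.comp ENNReal.measurable_log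

end LogRatio

/-- The dyadic scale `2^{-j}`. -/
noncomputable def dyad (j : ℕ) : ℝ := (1 / 2) ^ j

theorem dyad_pos (j : ℕ) : 0 < dyad j := by unfold dyad; positivity

theorem dyad_le_one (j : ℕ) : dyad j ≤ 1 := pow_le_one₀ (by norm_num) (by norm_num)

theorem dyad_lt_one {j : ℕ} (hj : 0 < j) : dyad j < 1 :=
  pow_lt_one₀ (by norm_num) (by norm_num) hj.ne'

theorem tendsto_dyad : Tendsto dyad atTop (𝓝[>] 0) :=
  tendsto_nhdsWithin_iff.2 ⟨tendsto_pow_atTop_nhds_zero_of_lt_one (by norm_num) (by norm_num),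
    Eventually.of_forall dyad_pos⟩

theorem dyad_rpow (j : ℕ) (s : ℝ) : dyad j ^ s = (1 / 2 : ℝ) ^ (j * s) := by
  rw [dyad, ← Real.rpow_natCast, ← Real.rpow_mul (by norm_num)]

theorem ofReal_dyad_rpow_add (j : ℕ) (s t : ℝ) :
    ENNReal.ofReal (dyad j ^ (s + t)) =
      ENNReal.ofReal (dyad j ^ s) * ENNReal.ofReal (dyad j ^ t) := by
  rw [Real.rpow_add (dyad_pos j), ENNReal.ofReal_mul (Real.rpow_nonneg (dyad_pos j).le _)]

theorem exists_dyad_near {r : ℝ} (h0 : 0 < r) {J : ℕ} (h : r ≤ dyad J) :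
    ∃ j, J ≤ j ∧ dyad (j + 1) < r ∧ r ≤ dyad j := by
  obtain ⟨n, h1, h2⟩ := exists_nat_pow_near_of_lt_one h0 (h.trans (dyad_le_one J))
    (by norm_num : (0 : ℝ) < 1 / 2) (by norm_num)
  refine ⟨n, ?_, h1, h2⟩
  by_contra! hn
  have : dyad J ≤ dyad (n + 1) := pow_le_pow_of_le_one (by norm_num) (by norm_num) hn
  exact absurd (h.trans this) (not_le.2 h1)

theorem eventually_nhdsGT_of_dyad {p : ℝ → Prop} {q : ℕ → Prop} (hq : ∀ᶠ j in atTop, q j)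
    (h : ∀ j r, q j → dyad (j + 1) < r → r ≤ dyad j → p r) : ∀ᶠ r in 𝓝[>] 0, p r := by
  obtain ⟨J, hJ⟩ := eventually_atTop.1 hq
  filter_upwards [Ioc_mem_nhdsGT (dyad_pos J)] with r hr
  obtain ⟨j, hj, h1, h2⟩ := exists_dyad_near hr.1 hr.2
  exact h j r (hJ j hj) h1 h2

theorem eventually_rpow_dyad_le_rpow_dyad_succ {s t : ℝ} (hst : s < t) :
    ∀ᶠ j : ℕ in atTop, dyad j ^ t ≤ dyad (j + 1) ^ s := by
  filter_upwards [eventually_ge_atTop ⌈s / (t - s)⌉₊] with j hj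
  rw [dyad_rpow, dyad_rpow]
  apply Real.rpow_le_rpow_of_exponent_ge (by norm_num) (by norm_num)
  have := (Nat.le_ceil _).trans (Nat.cast_le (α := ℝ).2 hj)
  rw [div_le_iff₀ (by linarith)] at this
  push_cast
  linarith

theorem tendsto_poly_mul_rpow_dyad (C : ℝ) (p : ℕ) {ε : ℝ} (hε : 0 < ε) :
    Tendsto (fun j : ℕ => C * ((j : ℝ) + 1) ^ p * dyad j ^ ε) atTop (𝓝 0) := by
  have hgeom : Tendsto (fun n : ℕ => (n : ℝ) ^ p * ((1 / 2 : ℝ) ^ ε) ^ n) atTop (𝓝 0) :=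
    tendsto_pow_const_mul_const_pow_of_abs_lt_one p (by
      rw [abs_of_pos (by positivity)]
      exact Real.rpow_lt_one (by norm_num) (by norm_num) hε)
  have hshift := ((tendsto_add_atTop_iff_nat 1).2 hgeom).const_mul (C * ((1 / 2 : ℝ) ^ ε)⁻¹)
  rw [mul_zero] at hshift
  refine hshift.congr fun j => ?_
  rw [dyad_rpow, mul_comm (j : ℝ) ε, Real.rpow_mul_natCast (by norm_num), pow_succ]
  push_cast
  field_simp

/-- The two properties of `r ↦ η(B(z,r))`, for a probability measure `η`, that make its scaling
exponents computable along the dyadic scales. -/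
structure IsMassFunction (g : ℝ → ℝ≥0∞) : Prop where
  monotoneOn : MonotoneOn g (Set.Ioi 0)
  le_one : ∀ r, 0 < r → g r ≤ 1

theorem IsMassFunction.lowerExp_eq_liminf_dyad {g : ℝ → ℝ≥0∞} (hg : IsMassFunction g) :
    lowerExp g = liminf (fun j => logRatio (dyad j) (g (dyad j))) atTop := by
  refine le_antisymm (liminf_le_liminf_of_le tendsto_dyad)
    (EReal.ge_of_forall_gt_iff_ge.1 fun s hs => ?_)
  obtain ⟨t, hst, ht⟩ := EReal.lt_iff_exists_real_btwn.1 hs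
  refine le_liminf_of_le (by isBoundedDefault) <| eventually_nhdsGT_of_dyad
    (((eventually_lt_of_lt_liminf ht).and (eventually_rpow_dyad_le_rpow_dyad_succ
      (EReal.coe_lt_coe_iff.1 hst))).and (eventually_gt_atTop 0)) ?_
  rintro j r ⟨⟨hgt, hts⟩, hj⟩ hr1 hr2
  have hr0 : 0 < r := (dyad_pos _).trans hr1
  have hr : r < 1 := hr2.trans_lt (dyad_lt_one hj)
  rw [le_logRatio_iff hr0 hr]
  rcases lt_or_ge s 0 with h | h
  · refine (hg.le_one r hr0).trans (ENNReal.one_le_ofReal.2 ?_)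
    exact Real.one_le_rpow_of_pos_of_le_one_of_nonpos hr0 hr.le h.le
  · calc g r ≤ g (dyad j) := hg.monotoneOn hr0 (dyad_pos j) hr2
      _ ≤ ENNReal.ofReal (dyad j ^ t) := (le_logRatio_iff (dyad_pos j) (dyad_lt_one hj)).1 hgt.le
      _ ≤ ENNReal.ofReal (r ^ s) := by
        gcongr
        exact hts.trans (Real.rpow_le_rpow (dyad_pos _).le hr1.le h)

theorem IsMassFunction.upperExp_eq_limsup_dyad {g : ℝ → ℝ≥0∞} (hg : IsMassFunction g) :
    upperExp g = limsup (fun j => logRatio (dyad j) (g (dyad j))) atTop := by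
  refine le_antisymm (EReal.le_of_forall_lt_iff_le.1 fun s hs => ?_)
    (limsup_le_limsup_of_le (u := fun r => logRatio r (g r)) tendsto_dyad
      (by isBoundedDefault) (by isBoundedDefault))
  obtain ⟨t, ht, hts⟩ := EReal.lt_iff_exists_real_btwn.1 hs
  have hts : t < s := EReal.coe_lt_coe_iff.1 hts
  have hgt := (tendsto_add_atTop_nat 1).eventually (eventually_lt_of_limsup_lt ht)
  refine limsup_le_of_le (by isBoundedDefault) <| eventually_nhdsGT_of_dyad
    ((hgt.and (eventually_rpow_dyad_le_rpow_dyad_succ hts)).and (eventually_gt_atTop 0)) ?_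
  rintro j r ⟨⟨hgt, hpow⟩, hj⟩ hr1 hr2
  have hr0 : 0 < r := (dyad_pos _).trans hr1
  have hlow : ENNReal.ofReal (dyad (j + 1) ^ t) ≤ g (dyad (j + 1)) :=
    (logRatio_le_iff (dyad_pos _) (dyad_lt_one j.succ_pos)).1 hgt.le
  have ht0 : 0 ≤ t := by
    by_contra! h
    have := ENNReal.ofReal_le_one.1 (hlow.trans (hg.le_one _ (dyad_pos _)))
    exact this.not_gt (Real.one_lt_rpow_of_pos_of_lt_one_of_neg (dyad_pos _)
      (dyad_lt_one j.succ_pos) h)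
  rw [logRatio_le_iff hr0 (hr2.trans_lt (dyad_lt_one hj))]
  calc ENNReal.ofReal (r ^ s) ≤ ENNReal.ofReal (dyad (j + 1) ^ t) := by
        gcongr
        exact (Real.rpow_le_rpow hr0.le hr2 (ht0.trans hts.le)).trans hpow
    _ ≤ g (dyad (j + 1)) := hlow
    _ ≤ g r := hg.monotoneOn (dyad_pos _) hr0 hr1.le

/-- `g` is at most `h` up to subexponential factors along the dyadic scales. -/
def SubexpLE (g h : ℝ → ℝ≥0∞) : Prop :=
  ∀ ε : ℝ, 0 < ε → ∀ᶠ j : ℕ in atTop, ENNReal.ofReal (dyad j ^ ε) * g (dyad j) ≤ h (dyad j)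

namespace SubexpLE

variable {f g h : ℝ → ℝ≥0∞}

theorem trans (hfg : SubexpLE f g) (hgh : SubexpLE g h) : SubexpLE f h := fun ε hε => by
  filter_upwards [hfg (ε / 2) (half_pos hε), hgh (ε / 2) (half_pos hε)] with j h1 h2
  calc ENNReal.ofReal (dyad j ^ ε) * f (dyad j)
      = ENNReal.ofReal (dyad j ^ (ε / 2)) * (ENNReal.ofReal (dyad j ^ (ε / 2)) * f (dyad j)) := by
        rw [← mul_assoc, ← ofReal_dyad_rpow_add, add_halves]
    _ ≤ ENNReal.ofReal (dyad j ^ (ε / 2)) * g (dyad j) := by gcongr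
    _ ≤ h (dyad j) := h2

theorem of_le_poly_mul {C : ℝ} {p : ℕ}
    (hgh : ∀ᶠ j : ℕ in atTop, g (dyad j) ≤ ENNReal.ofReal (C * (j + 1) ^ p) * h (dyad j)) :
    SubexpLE g h := fun ε hε => by
  filter_upwards [hgh, (tendsto_poly_mul_rpow_dyad C p hε).eventually_le_const one_pos]
    with j hj hle
  calc ENNReal.ofReal (dyad j ^ ε) * g (dyad j)
      ≤ ENNReal.ofReal (dyad j ^ ε) * (ENNReal.ofReal (C * (j + 1) ^ p) * h (dyad j)) := by gcongr
    _ = ENNReal.ofReal (C * (j + 1) ^ p * dyad j ^ ε) * h (dyad j) := by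
        rw [← mul_assoc, ← ENNReal.ofReal_mul (Real.rpow_nonneg (dyad_pos j).le _),
          mul_comm (C * _)]
    _ ≤ 1 * h (dyad j) := by
        gcongr
        exact ENNReal.ofReal_le_one.2 hle
    _ = h (dyad j) := one_mul _

theorem eventually_logRatio_le (hgh : SubexpLE g h) {s t : ℝ} (hst : s < t) :
    ∀ᶠ j in atTop, logRatio (dyad j) (g (dyad j)) < s → logRatio (dyad j) (h (dyad j)) ≤ t := by
  filter_upwards [hgh (t - s) (sub_pos.2 hst), eventually_gt_atTop 0] with j hj hj0 hs
  rw [logRatio_le_iff (dyad_pos j) (dyad_lt_one hj0)]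
  calc ENNReal.ofReal (dyad j ^ t)
      = ENNReal.ofReal (dyad j ^ (t - s)) * ENNReal.ofReal (dyad j ^ s) := by
        rw [← ofReal_dyad_rpow_add, sub_add_cancel]
    _ ≤ ENNReal.ofReal (dyad j ^ (t - s)) * g (dyad j) := by
        gcongr
        exact (logRatio_le_iff (dyad_pos j) (dyad_lt_one hj0)).1 hs.le
    _ ≤ h (dyad j) := hj

theorem lowerExp_le (hgh : SubexpLE g h) (hg : IsMassFunction g) (hh : IsMassFunction h) :
    lowerExp h ≤ lowerExp g := by
  rw [hg.lowerExp_eq_liminf_dyad, hh.lowerExp_eq_liminf_dyad]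
  refine EReal.le_of_forall_lt_iff_le.1 fun s hs => ?_
  obtain ⟨t, ht, hst⟩ := EReal.lt_iff_exists_real_btwn.1 hs
  exact liminf_le_of_frequently_le ((frequently_lt_of_liminf_lt (by isBoundedDefault) ht).mp
    (hgh.eventually_logRatio_le (EReal.coe_lt_coe_iff.1 hst))) (by isBoundedDefault)

theorem upperExp_le (hgh : SubexpLE g h) (hg : IsMassFunction g) (hh : IsMassFunction h) :
    upperExp h ≤ upperExp g := by
  rw [hg.upperExp_eq_limsup_dyad, hh.upperExp_eq_limsup_dyad]
  refine EReal.le_of_forall_lt_iff_le.1 fun s hs => ?_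
  obtain ⟨t, ht, hst⟩ := EReal.lt_iff_exists_real_btwn.1 hs
  exact limsup_le_of_le (by isBoundedDefault) ((eventually_lt_of_limsup_lt ht).mp
    (hgh.eventually_logRatio_le (EReal.coe_lt_coe_iff.1 hst)))

end SubexpLE

section LocalDimension

variable {X : Type*} [PseudoMetricSpace X] [MeasurableSpace X]

theorem isMassFunction_measure_closedBall (η : Measure X) [IsProbabilityMeasure η] (z : X) :
    IsMassFunction fun r => η (Metric.closedBall z r) where
  monotoneOn _ _ _ _ h := measure_mono (Metric.closedBall_subset_closedBall h)
  le_one _ _ := prob_le_one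

variable [OpensMeasurableSpace X] [SecondCountableTopology X]

theorem measurable_measure_closedBall (η : Measure X) [SFinite η] (r : ℝ) :
    Measurable fun z => η (Metric.closedBall z r) :=
  measurable_measure_prodMk_left (ν := η) (s := {p : X × X | dist p.2 p.1 ≤ r})
    (measurableSet_le (by fun_prop) measurable_const)

theorem measurable_lowerLocDim (η : Measure X) [IsProbabilityMeasure η] :
    Measurable (lowerLocDim η) := by
  have hdyad := fun z => (isMassFunction_measure_closedBall η z).lowerExp_eq_liminf_dyad
  change Measurable fun z => lowerExp fun r => η (Metric.closedBall z r)
  simp only [hdyad]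
  exact Measurable.liminf fun j =>
    (measurable_logRatio (dyad_pos j).le (dyad_le_one j)).comp (measurable_measure_closedBall η _)

theorem measurable_upperLocDim (η : Measure X) [IsProbabilityMeasure η] :
    Measurable (upperLocDim η) := by
  have hdyad := fun z => (isMassFunction_measure_closedBall η z).upperExp_eq_limsup_dyad
  change Measurable fun z => upperExp fun r => η (Metric.closedBall z r)
  simp only [hdyad]
  exact Measurable.limsup fun j =>
    (measurable_logRatio (dyad_pos j).le (dyad_le_one j)).comp (measurable_measure_closedBall η _)

end LocalDimension

/-! ### Measure-theoretic tools -/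

section Measure

variable {X Y ι : Type*} [MeasurableSpace X] [MeasurableSpace Y]

theorem essInf_map_of_measurable {β : Type*} [CompleteLinearOrder β] [TopologicalSpace β]
    [OrderClosedTopology β] [SecondCountableTopology β] [MeasurableSpace β]
    [OpensMeasurableSpace β] {μ : Measure X} {f : X → Y} {g : Y → β} (hf : Measurable f)
    (hg : Measurable g) : essInf g (μ.map f) = essInf (g ∘ f) μ := by
  simp only [essInf_eq_sSup, Measure.map_apply hf (measurableSet_lt hg measurable_const)]
  rfl

theorem essInf_coe_min (μ : Measure X) [NeZero μ] (f : X → ℝ≥0∞) (c : ℝ≥0∞) :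
    essInf (fun x => ((min (f x) c : ℝ≥0∞) : EReal)) μ = (min (essInf f μ) c : ℝ≥0∞) :=
  (Monotone.map_liminf_of_continuousAt (F := ae μ) (f := fun t : ℝ≥0∞ => ((min t c : ℝ≥0∞) : EReal))
    (fun _ _ h => EReal.coe_ennreal_le_coe_ennreal_iff.2 (min_le_min_right _ h)) f
    (continuous_coe_ennreal_ereal.comp (continuous_id.min continuous_const)).continuousAt).symm

theorem essSup_coe_min (μ : Measure X) [NeZero μ] (f : X → ℝ≥0∞) (c : ℝ≥0∞) :
    essSup (fun x => ((min (f x) c : ℝ≥0∞) : EReal)) μ = (min (essSup f μ) c : ℝ≥0∞) :=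
  (Monotone.map_limsup_of_continuousAt (F := ae μ) (f := fun t : ℝ≥0∞ => ((min t c : ℝ≥0∞) : EReal))
    (fun _ _ h => EReal.coe_ennreal_le_coe_ennreal_iff.2 (min_le_min_right _ h)) f
    (continuous_coe_ennreal_ereal.comp (continuous_id.min continuous_const)).continuousAt).symm

theorem ae_subexpLE_of_measure_lt_mul_le {μ : Measure X} {u v : X → ℝ → ℝ≥0∞} {C : ℝ≥0∞}
    (hC : C ≠ ∞) {p : ℕ} (h : ∀ (j : ℕ) (c : ℝ≥0∞),
      μ {x | v x (dyad j) < c * u x (dyad j)} ≤ C * (j + 1) ^ p * c) :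
    ∀ᵐ x ∂μ, SubexpLE (u x) (v x) := by
  let q : ℕ → ℝ≥0∞ := fun j => (j : ℝ≥0∞) + 1
  have hq0 : ∀ j, q j ≠ 0 := fun j => by simp [q]
  have hqtop : ∀ j, q j ≠ ∞ := fun j => by simp [q]
  have hq : ∀ j, q j = ENNReal.ofReal (j + 1) := fun j => by
    rw [ENNReal.ofReal_add (by positivity) zero_le_one]; simp [q]
  have hsum : ∑' j, (q j ^ 2)⁻¹ ≠ ∞ := by
    have : Summable fun j : ℕ => (((j : ℝ) + 1) ^ 2)⁻¹ := by
      exact_mod_cast (summable_nat_add_iff 1).2 (Real.summable_nat_pow_inv.2 one_lt_two)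
    convert this.tsum_ofReal_ne_top using 3 with j
    rw [ENNReal.ofReal_inv_of_pos (by positivity), ENNReal.ofReal_pow (by positivity), hq]
  -- Borel–Cantelli with `c = (j + 1) ^ (-(p + 2))` at scale `2⁻ʲ`.
  have hbad : ∑' j, μ {x | v x (dyad j) < (q j ^ (p + 2))⁻¹ * u x (dyad j)} ≠ ∞ := by
    refine ne_top_of_le_ne_top (ENNReal.mul_ne_top hC hsum) ?_
    rw [← ENNReal.tsum_mul_left]
    refine ENNReal.tsum_le_tsum fun j => (h j _).trans_eq ?_
    rw [mul_assoc, pow_add, ENNReal.mul_inv (.inl (pow_ne_zero p (hq0 j)))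
      (.inl (ENNReal.pow_ne_top (hqtop j))), ← mul_assoc (_ ^ p),
      ENNReal.mul_inv_cancel (pow_ne_zero p (hq0 j)) (ENNReal.pow_ne_top (hqtop j)), one_mul]
  filter_upwards [ae_eventually_notMem hbad] with x hx
  refine SubexpLE.of_le_poly_mul (C := 1) (p := p + 2) (hx.mono fun j hj => ?_)
  rw [one_mul, ENNReal.ofReal_pow (by positivity), ← hq]
  exact (ENNReal.inv_mul_le_iff (pow_ne_zero _ (hq0 j)) (ENNReal.pow_ne_top (hqtop j))).1
    (not_lt.1 hj)

theorem measure_lt_mul_le_of_lintegral_le {μ : Measure X} {f : X → ℝ≥0∞} (hf : AEMeasurable f μ)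
    {g C : ℝ≥0∞} (h : ∫⁻ x, f x ∂μ ≤ C * g) (c : ℝ≥0∞) : μ {x | g < c * f x} ≤ C * c := by
  rcases eq_or_ne g 0 with rfl | hg0
  · rw [mul_zero, nonpos_iff_eq_zero, lintegral_eq_zero_iff' hf] at h
    refine (measure_eq_zero_iff_ae_notMem.2 (h.mono fun x hx => ?_)).trans_le zero_le
    simp [hx]
  rcases eq_or_ne g ∞ with rfl | hgtop
  · simp
  rw [← ENNReal.mul_le_mul_iff_left hg0 hgtop]
  calc μ {x | g < c * f x} * g ≤ g * μ {x | g ≤ c * f x} := by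
        rw [mul_comm]
        gcongr with x
        exact le_of_lt
    _ ≤ ∫⁻ x, c * f x ∂μ := mul_meas_ge_le_lintegral₀ (hf.const_mul c) g
    _ = c * ∫⁻ x, f x ∂μ := lintegral_const_mul'' c hf
    _ ≤ c * (C * g) := by gcongr
    _ = C * c * g := by ring

theorem measure_le_mul_of_forall_fiber_le [Countable ι] [MeasurableSpace ι]
    [MeasurableSingletonClass ι] {μ : Measure X} {q : X → ι} (hq : Measurable q) {B : Set X}
    {c : ℝ≥0∞} (h : ∀ x, μ (B ∩ q ⁻¹' {q x}) ≤ c * μ (q ⁻¹' {q x})) :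
    μ B ≤ c * μ Set.univ := by
  have hfiber : ∀ i, μ (B ∩ q ⁻¹' {i}) ≤ c * μ (q ⁻¹' {i}) := by
    intro i
    rcases (q ⁻¹' {i}).eq_empty_or_nonempty with he | ⟨x, rfl⟩
    · simp [he]
    · exact h x
  calc μ B ≤ μ (⋃ i, B ∩ q ⁻¹' {i}) := measure_mono fun x hx => Set.mem_iUnion.2 ⟨q x, hx, rfl⟩
    _ ≤ ∑' i, μ (B ∩ q ⁻¹' {i}) := measure_iUnion_le _
    _ ≤ ∑' i, c * μ (q ⁻¹' {i}) := ENNReal.tsum_le_tsum hfiber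
    _ = c * μ Set.univ := by
      rw [ENNReal.tsum_mul_left, ← tsum_univ (fun i => μ (q ⁻¹' {i})),
        tsum_measure_preimage_singleton Set.countable_univ fun i _ =>
          hq (measurableSet_singleton i), Set.preimage_univ]

theorem measure_le_card_mul {μ : Measure X} {F : Finset ι} {q : X → ι} {B : Set X} {c : ℝ≥0∞}
    (hF : ∀ x ∈ B, q x ∈ F) (h : ∀ x ∈ B, μ (B ∩ q ⁻¹' {q x}) ≤ c) : μ B ≤ F.card * c := by
  calc μ B ≤ μ (⋃ i ∈ F, B ∩ q ⁻¹' {i}) := measure_mono fun x hx =>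
        Set.mem_iUnion₂.2 ⟨q x, hF x hx, hx, rfl⟩
    _ ≤ ∑ i ∈ F, μ (B ∩ q ⁻¹' {i}) := measure_biUnion_finset_le _ _
    _ ≤ ∑ _i ∈ F, c := by
      refine Finset.sum_le_sum fun i _ => ?_
      rcases (B ∩ q ⁻¹' {i}).eq_empty_or_nonempty with he | ⟨x, hx, rfl⟩
      · simp [he]
      · exact h x hx
    _ = F.card * c := by simp

theorem measure_pi_le_of_forall_update [Fintype ι] [DecidableEq ι] {Ω : ι → Type*}
    [∀ j, MeasurableSpace (Ω j)] (ν : ∀ j, Measure (Ω j)) [∀ j, SigmaFinite (ν j)]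
    {S : Set (∀ j, Ω j)} (hS : MeasurableSet S) (i : ι) {c : ℝ≥0∞}
    (h : ∀ a, ν i {u | Function.update a i u ∈ S} ≤ c) :
    Measure.pi ν S ≤ c * ∏ j ∈ Finset.univ.erase i, ν j Set.univ := by
  rcases isEmpty_or_nonempty (∀ j, Ω j) with _ | ⟨⟨a₀⟩⟩
  · simp [S.eq_empty_of_isEmpty]
  have hslice : (fun a => ∫⁻ u, S.indicator 1 (Function.update a i u) ∂ν i) ≤ fun _ => c :=
    fun a => (lintegral_indicator_one (measurable_update a hS)).trans_le (h a)
  rw [← lintegral_indicator_one hS, lintegral_eq_lmarginal_univ (μ := ν) a₀,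
    lmarginal_erase' _ (measurable_one.indicator hS) (Finset.mem_univ i)]
  refine (lmarginal_mono hslice a₀).trans_eq ?_
  rw [lmarginal, lintegral_const, Measure.pi_univ, Finset.prod_coe_sort _ fun j => ν j Set.univ]

variable {E : Type*} [NormedAddCommGroup E] [NormedSpace ℝ E] [FiniteDimensional ℝ E]
  [MeasurableSpace E] [BorelSpace E]

theorem addHaar_preimage_linearMap_add_le (ν : Measure E) [ν.IsAddHaarMeasure] {L : E →ₗ[ℝ] E}
    {κ : ℝ} (hκ : 0 < κ) (hL : ∀ u, κ * ‖u‖ ≤ ‖L u‖) (b : E) (V : Set E) :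
    ν {u | L u + b ∈ V} ≤ ENNReal.ofReal (κ⁻¹ ^ Module.finrank ℝ E) * ν V := by
  have hdet : LinearMap.det L ≠ 0 := by
    refine fun h => (LinearMap.bot_lt_ker_of_det_eq_zero h).ne' ?_
    refine LinearMap.ker_eq_bot'.2 fun u hu => norm_le_zero_iff.1 ?_
    exact nonpos_of_mul_nonpos_right ((hL u).trans_eq (by rw [hu, norm_zero])) hκ
  have hpre := Measure.addHaar_preimage_linearMap ν hdet
  -- `|det L|⁻¹` is the ratio of the volumes of `L⁻¹ B(0,1) ⊆ B(0,κ⁻¹)` and `B(0,1)`.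
  have hball : L ⁻¹' Metric.closedBall 0 1 ⊆ Metric.closedBall 0 (κ⁻¹ * 1) := fun u hu => by
    rw [mem_closedBall_zero_iff, mul_one, ← one_div, le_div_iff₀' hκ]
    exact (hL u).trans (mem_closedBall_zero_iff.1 hu)
  have hle : ENNReal.ofReal |(LinearMap.det L)⁻¹| ≤
      ENNReal.ofReal (κ⁻¹ ^ Module.finrank ℝ E) := by
    refine (ENNReal.mul_le_mul_iff_left (Metric.measure_closedBall_pos ν (0 : E) one_pos).ne'
      measure_closedBall_lt_top.ne).1 ?_
    rw [← hpre, ← Measure.addHaar_closedBall_mul ν 0 (inv_nonneg.2 hκ.le) zero_le_one]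
    exact measure_mono hball
  calc ν {u | L u + b ∈ V} = ν (L ⁻¹' ((· + b) ⁻¹' V)) := rfl
    _ = ENNReal.ofReal |(LinearMap.det L)⁻¹| * ν V := by rw [hpre, measure_preimage_add_right]
    _ ≤ _ := by gcongr

end Measure

/-! ### Singular values -/

local notation "toOp" => Matrix.toEuclideanCLM (n := Fin _) (𝕜 := ℝ)

theorem volume_setOf_forall_abs_repr_le {ι F : Type*} [Fintype ι] [NormedAddCommGroup F]
    [InnerProductSpace ℝ F] [FiniteDimensional ℝ F] [MeasurableSpace F] [BorelSpace F]
    (b : OrthonormalBasis ι ℝ F) (c : ι → ℝ) :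
    volume {u | ∀ k, |b.repr u k| ≤ c k} = ∏ k, ENNReal.ofReal (2 * c k) := by
  have hmp := (EuclideanSpace.volume_preserving_symm_measurableEquiv_toLp ι).comp
    b.measurePreserving_repr
  have hbox : {u | ∀ k, |b.repr u k| ≤ c k} =
      (⇑(MeasurableEquiv.toLp 2 (ι → ℝ)).symm ∘ ⇑b.repr) ⁻¹'
        Set.univ.pi fun k => Set.Icc (-c k) (c k) := by
    ext u
    simp [abs_le, Pi.le_def, forall_and]
  rw [hbox, hmp.measure_preimage
    (MeasurableSet.univ_pi fun _ => measurableSet_Icc).nullMeasurableSet, volume_pi_pi]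
  simp only [Real.volume_Icc, sub_neg_eq_add, two_mul]

theorem min_div_self_mul_rpow_le {r α θ : ℝ} (hr : 0 ≤ r) (hα : 0 < α) (hθ0 : 0 ≤ θ)
    (hθ1 : θ ≤ 1) : min r α / α * α ^ θ ≤ r ^ θ := by
  have hmin : 0 ≤ min r α := le_min hr hα.le
  have hle : min r α / α ≤ 1 := div_le_one_of_le₀ (min_le_right _ _) hα.le
  calc min r α / α * α ^ θ ≤ (min r α / α) ^ θ * α ^ θ := by
        gcongr
        exact Real.self_le_rpow_of_le_one (by positivity) hle hθ1
    _ = min r α ^ θ := by rw [← Real.mul_rpow (by positivity) hα.le, div_mul_cancel₀ _ hα.ne']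
    _ ≤ r ^ θ := Real.rpow_le_rpow hmin (min_le_left _ _) hθ0

section SingularValues

variable {d : ℕ}

theorem singVal_nonneg (A : Matrix (Fin d) (Fin d) ℝ) (k : ℕ) : 0 ≤ singVal A k :=
  LinearMap.singularValues_nonneg _ _

theorem singVal_antitone (A : Matrix (Fin d) (Fin d) ℝ) : Antitone (singVal A) :=
  LinearMap.singularValues_antitone _

/-- An orthonormal basis of right singular vectors of `A`, the `k`-th one belonging to
`singVal A k`. -/
noncomputable def rightSingularBasis (A : Matrix (Fin d) (Fin d) ℝ) :
    OrthonormalBasis (Fin d) ℝ (Euc d) :=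
  (Matrix.toEuclideanLin A).isSymmetric_adjoint_comp_self.eigenvectorBasis
    finrank_euclideanSpace_fin

theorem norm_sq_toOp_apply (A : Matrix (Fin d) (Fin d) ℝ) (u : Euc d) :
    ‖toOp A u‖ ^ 2 = ∑ k : Fin d, (singVal A k * (rightSingularBasis A).repr u k) ^ 2 := by
  set L := Matrix.toEuclideanLin A with hL
  have hfr : Module.finrank ℝ (Euc d) = d := finrank_euclideanSpace_fin
  have hinner : ‖toOp A u‖ ^ 2 = inner ℝ ((LinearMap.adjoint L ∘ₗ L) u) u := by
    rw [LinearMap.comp_apply, LinearMap.adjoint_inner_left, real_inner_self_eq_norm_sq, hL,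
      ← Matrix.coe_toEuclideanCLM_eq_toEuclideanLin]
    rfl
  rw [hinner, ← (rightSingularBasis A).repr.inner_map_map, PiLp.inner_apply]
  refine Finset.sum_congr rfl fun k _ => ?_
  rw [rightSingularBasis, L.isSymmetric_adjoint_comp_self.eigenvectorBasis_apply_self_apply hfr u k,
    ← L.sq_singularValues_fin hfr k]
  simp only [singVal, ← hL, RCLike.ofReal_real_eq_id, id_eq, RCLike.inner_apply, conj_trivial]
  ring

theorem abs_repr_le_norm {ι F : Type*} [Fintype ι] [NormedAddCommGroup F] [InnerProductSpace ℝ F]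
    (b : OrthonormalBasis ι ℝ F) (u : F) (k : ι) : |b.repr u k| ≤ ‖u‖ := by
  simpa only [LinearIsometryEquiv.norm_map, Real.norm_eq_abs] using PiLp.norm_apply_le (b.repr u) k

theorem singVal_mul_abs_repr_le (A : Matrix (Fin d) (Fin d) ℝ) (u : Euc d) (k : Fin d) :
    singVal A k * |(rightSingularBasis A).repr u k| ≤ ‖toOp A u‖ := by
  refine le_of_sq_le_sq ?_ (norm_nonneg _)
  rw [mul_pow, sq_abs, ← mul_pow, norm_sq_toOp_apply]
  exact Finset.single_le_sum (f := fun k : Fin d =>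
    (singVal A k * (rightSingularBasis A).repr u k) ^ 2) (fun _ _ => sq_nonneg _)
    (Finset.mem_univ k)

/-- The ratio `∏_k min (r, α_k(A)) / α_k(A)`, which is `Z_{x ∧ y}(r)` for `A = T_{x ∧ y}`. -/
noncomputable def truncRatio (A : Matrix (Fin d) (Fin d) ℝ) (r : ℝ) : ℝ :=
  ∏ k ∈ Finset.range d, min r (singVal A k) / singVal A k

variable (A : Matrix (Fin d) (Fin d) ℝ) {r : ℝ}

theorem min_div_singVal_nonneg (hr : 0 ≤ r) (k : ℕ) : 0 ≤ min r (singVal A k) / singVal A k :=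
  div_nonneg (le_min hr (singVal_nonneg A k)) (singVal_nonneg A k)

theorem min_div_singVal_le_one (r : ℝ) (k : ℕ) : min r (singVal A k) / singVal A k ≤ 1 :=
  div_le_one_of_le₀ (min_le_right _ _) (singVal_nonneg A k)

theorem truncRatio_nonneg (hr : 0 ≤ r) : 0 ≤ truncRatio A r :=
  Finset.prod_nonneg fun k _ => min_div_singVal_nonneg A hr k

theorem truncRatio_le_one (hr : 0 ≤ r) : truncRatio A r ≤ 1 :=
  Finset.prod_le_one (fun k _ => min_div_singVal_nonneg A hr k)
    fun k _ => min_div_singVal_le_one A r k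

theorem truncRatio_mono (hr : 0 ≤ r) {s : ℝ} (h : r ≤ s) : truncRatio A r ≤ truncRatio A s :=
  Finset.prod_le_prod (fun k _ => min_div_singVal_nonneg A hr k) fun k _ =>
    div_le_div_of_nonneg_right (min_le_min_right _ h) (singVal_nonneg A k)

theorem truncRatio_le_prod_range (hr : 0 ≤ r) {n : ℕ} (hn : n ≤ d) :
    truncRatio A r ≤ ∏ k ∈ Finset.range n, min r (singVal A k) / singVal A k := by
  rw [truncRatio, ← Finset.prod_range_mul_prod_Ico _ hn]
  exact mul_le_of_le_one_right (Finset.prod_nonneg fun k _ => min_div_singVal_nonneg A hr k)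
    (Finset.prod_le_one (fun k _ => min_div_singVal_nonneg A hr k)
      fun k _ => min_div_singVal_le_one A r k)

theorem truncRatio_le_pow_div_abs_det (hr : 0 ≤ r) : truncRatio A r ≤ r ^ d / |A.det| := by
  rw [← prod_singVal, truncRatio, Finset.prod_div_distrib]
  refine div_le_div_of_nonneg_right ?_ (Finset.prod_nonneg fun k _ => singVal_nonneg A k)
  calc ∏ k ∈ Finset.range d, min r (singVal A k) ≤ ∏ _k ∈ Finset.range d, r :=
        Finset.prod_le_prod (fun k _ => le_min hr (singVal_nonneg A k)) fun k _ => min_le_left _ _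
    _ = r ^ d := by rw [Finset.prod_const, Finset.card_range]

variable {A} (hA : A.det ≠ 0)
include hA

theorem truncRatio_eq_one (h : opNorm A ≤ r) : truncRatio A r = 1 :=
  Finset.prod_eq_one fun k hk => by
    rw [min_eq_right ((singVal_le_opNorm A (Finset.mem_range.1 hk)).trans h),
      div_self (singVal_pos hA (Finset.mem_range.1 hk)).ne']

theorem pow_le_truncRatio (hA1 : opNorm A ≤ 1) (hr : 0 ≤ r) (hr1 : r ≤ 1) :
    r ^ d ≤ truncRatio A r := by
  calc r ^ d = ∏ _k ∈ Finset.range d, r := by simp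
    _ ≤ truncRatio A r := Finset.prod_le_prod (fun _ _ => hr) fun k hk => by
      have hpos := singVal_pos hA (Finset.mem_range.1 hk)
      rw [le_div_iff₀ hpos]
      exact le_min (mul_le_of_le_one_right hr ((singVal_le_opNorm A (Finset.mem_range.1 hk)).trans
        hA1)) (mul_le_of_le_one_left hpos.le hr1)

theorem eventually_truncRatio_le_rpow {s : ℝ} (hs : s < d) :
    ∀ᶠ r in 𝓝[>] 0, truncRatio A r ≤ r ^ s := by
  have hlim : Tendsto (fun r : ℝ => r ^ (d - s)) (𝓝[>] 0) (𝓝 0) := by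
    have := (Real.continuousAt_rpow_const 0 (d - s) (.inr (sub_nonneg.2 hs.le))).tendsto
    rw [Real.zero_rpow (sub_pos.2 hs).ne'] at this
    exact this.mono_left nhdsWithin_le_nhds
  filter_upwards [hlim.eventually_le_const (abs_pos.2 hA), self_mem_nhdsWithin] with r hr hr0
  have hr0 : 0 < r := hr0
  refine (truncRatio_le_pow_div_abs_det A hr0.le).trans ((div_le_iff₀ (abs_pos.2 hA)).2 ?_)
  calc r ^ d = r ^ s * r ^ (d - s) := by
        rw [← Real.rpow_add hr0, add_sub_cancel, Real.rpow_natCast]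
    _ ≤ r ^ s * |A.det| := by gcongr

theorem truncRatio_mul_svf_le (hr : 0 ≤ r) {s : ℝ} (hs : 0 ≤ s) (hsd : s < d) :
    truncRatio A r * svf s A ≤ r ^ s := by
  set k := ⌊s⌋₊ with hk
  have hkd : k < d := (Nat.floor_lt hs).2 hsd
  have hα := singVal_pos hA hkd
  have hθ0 : 0 ≤ s - k := sub_nonneg.2 (Nat.floor_le hs)
  have hθ1 : s - k ≤ 1 := by linarith [Nat.lt_floor_add_one s]
  have hfactor := min_div_singVal_nonneg A hr
  have hhead : (∏ i ∈ Finset.range k, min r (singVal A i) / singVal A i) *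
      ∏ i ∈ Finset.range k, singVal A i ≤ r ^ k := by
    rw [← Finset.prod_mul_distrib, ← Finset.card_range k, ← Finset.prod_const, Finset.card_range]
    refine Finset.prod_le_prod (fun i _ => mul_nonneg (hfactor i) (singVal_nonneg A i))
      fun i hi => ?_
    rw [div_mul_cancel₀ _ (singVal_pos hA ((Finset.mem_range.1 hi).trans hkd)).ne']
    exact min_le_left _ _
  have hpow : 0 ≤ singVal A k ^ (s - k) := Real.rpow_nonneg hα.le _
  rw [svf, if_pos hsd, ← hk]
  calc _ ≤ (∏ i ∈ Finset.range (k + 1), min r (singVal A i) / singVal A i) *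
          ((∏ i ∈ Finset.range k, singVal A i) * singVal A k ^ (s - k)) :=
        mul_le_mul_of_nonneg_right (truncRatio_le_prod_range A hr hkd)
          (mul_nonneg (Finset.prod_nonneg fun i _ => singVal_nonneg A i) hpow)
    _ = (∏ i ∈ Finset.range k, min r (singVal A i) / singVal A i) *
          (∏ i ∈ Finset.range k, singVal A i) *
          (min r (singVal A k) / singVal A k * singVal A k ^ (s - k)) := by
        rw [Finset.prod_range_succ]
        ring
    _ ≤ r ^ k * r ^ (s - k) := mul_le_mul hhead (min_div_self_mul_rpow_le hr hα hθ0 hθ1)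
        (mul_nonneg (hfactor k) hpow) (pow_nonneg hr k)
    _ = r ^ s := by
        rw [← Real.rpow_natCast, ← Real.rpow_add_of_nonneg hr (Nat.cast_nonneg k) hθ0,
          add_sub_cancel]

theorem truncRatio_singVal_floor_mul_svf {s : ℝ} (hs : 0 ≤ s) (hsd : s < d) :
    truncRatio A (singVal A ⌊s⌋₊) * svf s A = singVal A ⌊s⌋₊ ^ s := by
  set k := ⌊s⌋₊ with hk
  have hkd : k < d := (Nat.floor_lt hs).2 hsd
  have hα := fun {i} (hi : i < d) => singVal_pos hA hi
  have htail : ∏ i ∈ Finset.Ico k d, min (singVal A k) (singVal A i) / singVal A i = 1 :=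
    Finset.prod_eq_one fun i hi => by
      obtain ⟨hki, hid⟩ := Finset.mem_Ico.1 hi
      rw [min_eq_right (singVal_antitone A hki), div_self (hα hid).ne']
  have hhead : (∏ i ∈ Finset.range k, min (singVal A k) (singVal A i) / singVal A i) *
      ∏ i ∈ Finset.range k, singVal A i = singVal A k ^ k := by
    rw [← Finset.prod_mul_distrib, ← Finset.card_range k, ← Finset.prod_const, Finset.card_range]
    refine Finset.prod_congr rfl fun i hi => ?_
    have hik := Finset.mem_range.1 hi
    rw [min_eq_left (singVal_antitone A hik.le), div_mul_cancel₀ _ (hα (hik.trans hkd)).ne']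
  rw [truncRatio, ← Finset.prod_range_mul_prod_Ico _ hkd.le, htail, mul_one, svf, if_pos hsd, ← hk,
    ← mul_assoc, hhead, ← Real.rpow_natCast, ← Real.rpow_add (hα hkd), add_sub_cancel]

theorem volume_closedBall_inter_preimage_closedBall_le {R : ℝ} (hR : 1 ≤ R) (hr : 0 ≤ r) :
    volume {u : Euc d | ‖u‖ ≤ R ∧ ‖toOp A u‖ ≤ r} ≤
      ENNReal.ofReal ((2 * R) ^ d * truncRatio A r) := by
  have hR0 : 0 ≤ R := zero_le_one.trans hR
  have hbox : {u : Euc d | ‖u‖ ≤ R ∧ ‖toOp A u‖ ≤ r} ⊆ {u | ∀ k,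
      |(rightSingularBasis A).repr u k| ≤ R * (min r (singVal A k) / singVal A k)} := by
    rintro u ⟨huR, hur⟩ k
    have hα := singVal_pos hA k.2
    have hu := abs_repr_le_norm (rightSingularBasis A) u k
    rw [mul_div_assoc', le_div_iff₀ hα, mul_min_of_nonneg _ _ hR0, le_min_iff]
    constructor
    · calc _ ≤ r := by
            rw [mul_comm]
            exact (singVal_mul_abs_repr_le A u k).trans hur
        _ ≤ R * r := le_mul_of_one_le_left hr hR
    · exact mul_le_mul_of_nonneg_right (hu.trans huR) hα.le
  refine (measure_mono hbox).trans_eq ?_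
  rw [volume_setOf_forall_abs_repr_le, ← ENNReal.ofReal_prod_of_nonneg fun (k : Fin d) _ =>
    mul_nonneg zero_le_two (mul_nonneg hR0 (min_div_singVal_nonneg A hr k)), truncRatio,
    ← Fin.prod_univ_eq_prod_range fun k => min r (singVal A k) / singVal A k]
  simp only [← mul_assoc, Finset.prod_mul_distrib, Fin.prod_const]
  rw [mul_pow]

end SingularValues

section Cells

variable {d : ℕ} (A : Matrix (Fin d) (Fin d) ℝ) (r : ℝ)

/-- The number of cells per unit length along the `k`-th right singular vector of `A`: the image
under `A` of a cell of side `1 / cellDensity A r k` has side `r / √d` in that direction. -/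
noncomputable def cellDensity (k : ℕ) : ℝ := singVal A k * √d / r

/-- The index of the cell of `u`, for the partition of `ℝ^d` along the right singular vectors of `A`
into boxes whose images under `A` are cubes of diameter `r`. -/
noncomputable def cellIndex (u : Euc d) (k : Fin d) : ℤ :=
  ⌊(rightSingularBasis A).repr u k * cellDensity A r k⌋

/-- A finite set of indices containing those of all cells that meet the ball `B(0,R)`. -/
noncomputable def cellWindow (R : ℝ) : Finset (Fin d → ℤ) :=
  Fintype.piFinset fun k => Finset.Icc ⌊-(R * cellDensity A r k)⌋ ⌊R * cellDensity A r k⌋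

variable {r}

theorem cellDensity_nonneg (hr : 0 ≤ r) (k : ℕ) : 0 ≤ cellDensity A r k :=
  div_nonneg (mul_nonneg (singVal_nonneg A k) (Real.sqrt_nonneg _)) hr

theorem cellIndex_mem_cellWindow (hr : 0 ≤ r) {R : ℝ} {u : Euc d} (hu : ‖u‖ ≤ R) :
    cellIndex A r u ∈ cellWindow A r R := by
  refine Fintype.mem_piFinset.2 fun k => ?_
  have hrepr := abs_le.1 ((abs_repr_le_norm (rightSingularBasis A) u k).trans hu)
  have he := cellDensity_nonneg A hr k
  refine Finset.mem_Icc.2 ⟨Int.floor_mono ?_, Int.floor_mono ?_⟩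
  · rw [← neg_mul]
    exact mul_le_mul_of_nonneg_right hrepr.1 he
  · exact mul_le_mul_of_nonneg_right hrepr.2 he

theorem norm_toOp_sub_le_of_cellIndex_eq (hr : 0 < r) {u u' : Euc d}
    (h : cellIndex A r u = cellIndex A r u') : ‖toOp A (u - u')‖ ≤ r := by
  have hcoord : ∀ k : Fin d,
      (singVal A k * (rightSingularBasis A).repr (u - u') k) ^ 2 ≤ r ^ 2 / d := by
    intro k
    have hd : (0 : ℝ) < √d := Real.sqrt_pos.2 (by exact_mod_cast k.pos)
    have hlt := Int.abs_sub_lt_one_of_floor_eq_floor (congrFun h k)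
    rw [← sub_mul, cellDensity, ← mul_div_assoc, abs_div, abs_of_pos hr, div_lt_one hr,
      ← mul_assoc, abs_mul, abs_of_pos hd, ← lt_div_iff₀ hd] at hlt
    calc _ = |((rightSingularBasis A).repr u k - (rightSingularBasis A).repr u' k) *
            singVal A k| ^ 2 := by
          rw [sq_abs, map_sub, PiLp.sub_apply, mul_comm]
      _ ≤ (r / √d) ^ 2 := by gcongr
      _ = r ^ 2 / d := by rw [div_pow, Real.sq_sqrt (Nat.cast_nonneg d)]
  refine le_of_sq_le_sq ?_ hr.le
  calc ‖toOp A (u - u')‖ ^ 2 ≤ ∑ _k : Fin d, r ^ 2 / d := by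
        rw [norm_sq_toOp_apply]
        exact Finset.sum_le_sum fun k _ => hcoord k
    _ = d * (r ^ 2 / d) := by rw [Finset.sum_const, Finset.card_fin, nsmul_eq_mul]
    _ = r ^ 2 * (d / d) := mul_div_left_comm _ _ _
    _ ≤ r ^ 2 := mul_le_of_le_one_right (sq_nonneg r) (div_self_le_one _)

theorem card_Icc_floor_neg_floor_le {t : ℝ} (ht : 0 ≤ t) :
    ((Finset.Icc ⌊-t⌋ ⌊t⌋).card : ℝ) ≤ 2 * t + 2 := by
  have hle : ⌊-t⌋ ≤ ⌊t⌋ := Int.floor_mono (by linarith)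
  have hcard : ((Finset.Icc ⌊-t⌋ ⌊t⌋).card : ℤ) = ⌊t⌋ + 1 - ⌊-t⌋ := by
    rw [Int.card_Icc, Int.toNat_of_nonneg (by lia)]
  have hcard : ((Finset.Icc ⌊-t⌋ ⌊t⌋).card : ℝ) = ⌊t⌋ + 1 - ⌊-t⌋ := by exact_mod_cast hcard
  linarith [Int.floor_le t, Int.lt_floor_add_one (-t)]

theorem cellDensity_mul_min_div_singVal_le (hr : 0 ≤ r) (k : ℕ) :
    cellDensity A r k * (min r (singVal A k) / singVal A k) ≤ √d := by
  rcases (singVal_nonneg A k).eq_or_lt with h | h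
  · simp [← h]
  calc cellDensity A r k * (min r (singVal A k) / singVal A k)
      = √d * (min r (singVal A k) / r) := by
        rw [cellDensity]
        field_simp
    _ ≤ √d := mul_le_of_le_one_right (Real.sqrt_nonneg _)
        (div_le_one_of_le₀ (min_le_left _ _) hr)

theorem card_cellWindow_mul_truncRatio_le (hr : 0 ≤ r) {R : ℝ} (hR : 0 ≤ R) :
    ((cellWindow A r R).card : ℝ) * truncRatio A r ≤ (2 * R * √d + 2) ^ d := by
  rw [cellWindow, Fintype.card_piFinset, truncRatio, ← Fin.prod_univ_eq_prod_range fun k =>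
    min r (singVal A k) / singVal A k, Nat.cast_prod, ← Finset.prod_mul_distrib, ← Fin.prod_const]
  have hfactor := fun k => min_div_singVal_nonneg A hr k
  refine Finset.prod_le_prod (fun k _ => mul_nonneg (Nat.cast_nonneg _) (hfactor k)) fun k _ => ?_
  have he := cellDensity_nonneg A hr k
  calc _ ≤ (2 * (R * cellDensity A r k) + 2) * (min r (singVal A k) / singVal A k) := by
        gcongr
        · exact hfactor k
        · exact card_Icc_floor_neg_floor_le (mul_nonneg hR he)
    _ = 2 * R * (cellDensity A r k * (min r (singVal A k) / singVal A k)) +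
          2 * (min r (singVal A k) / singVal A k) := by ring
    _ ≤ 2 * R * √d + 2 * 1 := by
        gcongr
        · exact cellDensity_mul_min_div_singVal_le A hr k
        · exact min_div_singVal_le_one A r k
    _ = 2 * R * √d + 2 := by rw [mul_one]

end Cells

/-! ### The coding map -/

theorem toOp_mul_apply {d : ℕ} (A B : Matrix (Fin d) (Fin d) ℝ) (v : Euc d) :
    toOp (A * B) v = toOp A (toOp B v) := by
  rw [map_mul]
  rfl

section CodingMap

variable {m d : ℕ} (T : Fin m → Matrix (Fin d) (Fin d) ℝ)

/-- The largest of the norms `‖T_i‖`. -/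
noncomputable def contractionRatio : ℝ := ⨆ i, opNorm (T i)

/-- The sequence `x` without its first `n` symbols. -/
def shiftBy (n : ℕ) (x : Shift m) : Shift m := fun k => x (n + k)

theorem contractionRatio_nonneg : 0 ≤ contractionRatio T := Real.iSup_nonneg fun _ => norm_nonneg _

theorem opNorm_le_contractionRatio (i : Fin m) : opNorm (T i) ≤ contractionRatio T :=
  le_ciSup (f := fun i => opNorm (T i)) (Finite.bddAbove_range _) i

variable {T}

theorem contractionRatio_lt {c : ℝ} (hc : 0 < c) (h : ∀ i, opNorm (T i) < c) :
    contractionRatio T < c := by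
  rcases isEmpty_or_nonempty (Fin m) with hm | hm
  · rwa [contractionRatio, Real.iSup_of_isEmpty]
  · obtain ⟨i, hi⟩ := exists_eq_ciSup_of_finite (f := fun i => opNorm (T i))
    exact hi.symm.trans_lt (h i)

theorem opNorm_prefixProd_le (x : Shift m) (n : ℕ) :
    opNorm (prefixProd T x n) ≤ contractionRatio T ^ n := by
  induction n with
  | zero =>
    simp only [prefixProd, opNorm, map_one, pow_zero]
    exact ContinuousLinearMap.norm_id_le
  | succ n ih =>
    rw [prefixProd, pow_succ]
    exact (opNorm_mul_le _ _).trans (mul_le_mul ih (opNorm_le_contractionRatio T _)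
      (norm_nonneg _) (pow_nonneg (contractionRatio_nonneg T) n))

theorem norm_toOp_prefixProd_apply_le (x : Shift m) (n : ℕ) (v : Euc d) :
    ‖toOp (prefixProd T x n) v‖ ≤ contractionRatio T ^ n * ‖v‖ :=
  (ContinuousLinearMap.le_opNorm _ _).trans
    (mul_le_mul_of_nonneg_right (opNorm_prefixProd_le x n) (norm_nonneg _))

theorem det_prefixProd_ne_zero (hT : ∀ i, (T i).det ≠ 0) (x : Shift m) (n : ℕ) :
    (prefixProd T x n).det ≠ 0 := by
  induction n with
  | zero => simp [prefixProd]
  | succ n ih =>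
    rw [prefixProd, Matrix.det_mul]
    exact mul_ne_zero ih (hT _)

theorem prefixProd_congr {x y : Shift m} {n : ℕ} (h : y ∈ PiNat.cylinder x n) :
    prefixProd T y n = prefixProd T x n := by
  induction n with
  | zero => rfl
  | succ n ih =>
    rw [prefixProd, prefixProd, ih (PiNat.cylinder_anti x n.le_succ h), h n n.lt_succ_self]

theorem prefixProd_add (x : Shift m) (n k : ℕ) :
    prefixProd T x (n + k) = prefixProd T x n * prefixProd T (shiftBy n x) k := by
  induction k with
  | zero => simp [prefixProd]
  | succ k ih =>
    rw [← add_assoc, prefixProd, ih, prefixProd, mul_assoc]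
    rfl

theorem isLocallyConstant_prefixProd (n : ℕ) :
    IsLocallyConstant fun x : Shift m => prefixProd T x n :=
  (IsLocallyConstant.iff_exists_open _).2 fun x => ⟨PiNat.cylinder x n,
    PiNat.isOpen_cylinder _ x n, PiNat.self_mem_cylinder x n, fun _ hy => prefixProd_congr hy⟩

theorem measurable_comp_prefixProd {β : Type*} [MeasurableSpace β]
    (F : Matrix (Fin d) (Fin d) ℝ → β) (n : ℕ) :
    Measurable fun x : Shift m => F (prefixProd T x n) := fun s _ =>
  ((isLocallyConstant_prefixProd n).comp F s).measurableSet

theorem ifsComp_apply (a : Fin m → Euc d) (x : Shift m) (n : ℕ) (v : Euc d) :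
    ifsComp T a x n v = toOp (prefixProd T x n) v +
      ∑ k ∈ Finset.range n, toOp (prefixProd T x k) (a (x k)) := by
  induction n generalizing v with
  | zero => simp [ifsComp, prefixProd]
  | succ n ih =>
    rw [ifsComp, Function.comp_apply, ih, ifsMap, map_add, ← toOp_mul_apply,
      Finset.sum_range_succ, prefixProd]
    abel

variable (hρ : contractionRatio T < 1)
include hρ

theorem summable_toOp_prefixProd_apply (a : Fin m → Euc d) (x : Shift m) :
    Summable fun k => toOp (prefixProd T x k) (a (x k)) := by
  refine Summable.of_norm_bounded
    ((summable_geometric_of_lt_one (contractionRatio_nonneg T) hρ).mul_right ‖a‖) fun k => ?_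
  exact (norm_toOp_prefixProd_apply_le x k _).trans
    (mul_le_mul_of_nonneg_left (norm_le_pi_norm a _) (pow_nonneg (contractionRatio_nonneg T) k))

theorem tendsto_ifsComp (a : Fin m → Euc d) (x : Shift m) :
    Tendsto (fun n => ifsComp T a x n 0) atTop
      (𝓝 (∑' k, toOp (prefixProd T x k) (a (x k)))) := by
  simp only [ifsComp_apply, map_zero, zero_add]
  exact (summable_toOp_prefixProd_apply hρ a x).hasSum.tendsto_sum_nat

theorem codingMap_eq_tsum (a : Fin m → Euc d) (x : Shift m) :
    codingMap T a x = ∑' k, toOp (prefixProd T x k) (a (x k)) :=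
  (tendsto_ifsComp hρ a x).limUnder_eq

theorem norm_codingMap_le (a : Fin m → Euc d) (x : Shift m) :
    ‖codingMap T a x‖ ≤ (1 - contractionRatio T)⁻¹ * ‖a‖ := by
  rw [codingMap_eq_tsum hρ]
  refine tsum_of_norm_bounded
    ((hasSum_geometric_of_lt_one (contractionRatio_nonneg T) hρ).mul_right ‖a‖) fun k => ?_
  exact (norm_toOp_prefixProd_apply_le x k _).trans
    (mul_le_mul_of_nonneg_left (norm_le_pi_norm a _) (pow_nonneg (contractionRatio_nonneg T) k))

theorem codingMap_eq_sum_add (a : Fin m → Euc d) (x : Shift m) (n : ℕ) :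
    codingMap T a x = ∑ k ∈ Finset.range n, toOp (prefixProd T x k) (a (x k)) +
      toOp (prefixProd T x n) (codingMap T a (shiftBy n x)) := by
  rw [codingMap_eq_tsum hρ, codingMap_eq_tsum hρ,
    ← (summable_toOp_prefixProd_apply hρ a x).sum_add_tsum_nat_add n,
    ContinuousLinearMap.map_tsum _ (summable_toOp_prefixProd_apply hρ a _)]
  congr 2
  funext k
  rw [← toOp_mul_apply, ← prefixProd_add, add_comm k n]
  rfl

theorem codingMap_sub (a : Fin m → Euc d) {x y : Shift m} {n : ℕ} (h : y ∈ PiNat.cylinder x n) :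
    codingMap T a x - codingMap T a y = toOp (prefixProd T x n)
      (codingMap T a (shiftBy n x) - codingMap T a (shiftBy n y)) := by
  have hsum : ∑ k ∈ Finset.range n, toOp (prefixProd T y k) (a (y k)) =
      ∑ k ∈ Finset.range n, toOp (prefixProd T x k) (a (x k)) :=
    Finset.sum_congr rfl fun k hk => by
      have hk := Finset.mem_range.1 hk
      rw [h k hk, prefixProd_congr (PiNat.cylinder_anti x hk.le h)]
  rw [codingMap_eq_sum_add hρ a x n, codingMap_eq_sum_add hρ a y n, prefixProd_congr h, hsum,
    map_sub]
  abel

theorem measurable_codingMap_uncurry :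
    Measurable fun p : (Fin m → Euc d) × Shift m => codingMap T p.1 p.2 := by
  have hmap : ∀ k, Continuous fun p : (Fin m → Euc d) × Shift m =>
      toOp (prefixProd T p.2 k) := fun k =>
    ((isLocallyConstant_prefixProd k).comp fun A => toOp A).continuous.comp continuous_snd
  have happly : Continuous fun q : (Fin m → Euc d) × Fin m => q.1 q.2 :=
    continuous_prod_of_discrete_right.2 fun i => continuous_apply i
  have hsymbol : ∀ k, Continuous fun p : (Fin m → Euc d) × Shift m => p.1 (p.2 k) := fun k =>
    happly.comp (continuous_fst.prodMk ((continuous_apply k).comp continuous_snd))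
  refine measurable_of_tendsto_metrizable
    (f := fun n (p : (Fin m → Euc d) × Shift m) => ifsComp T p.1 p.2 n 0) (fun n => ?_)
    (tendsto_pi_nhds.2 fun p => ?_)
  · simp only [ifsComp_apply, map_zero, zero_add]
    exact (continuous_finsetSum _ fun k _ => (hmap k).clm_apply (hsymbol k)).measurable
  · rw [codingMap_eq_tsum hρ]
    exact tendsto_ifsComp hρ _ _

theorem measurable_codingMap (a : Fin m → Euc d) : Measurable (codingMap T a) :=
  Measurable.of_uncurry_left (f := codingMap T) (measurable_codingMap_uncurry hρ)

end CodingMap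

/-! ### Weights of cylinders -/

section Weights

variable {m d : ℕ} {T : Fin m → Matrix (Fin d) (Fin d) ℝ} {μ : Measure (Shift m)} {x y : Shift m}

theorem Zfun_of_ne (h : x ≠ y) (r : ℝ) :
    Zfun T x y r = truncRatio (prefixProd T x (PiNat.firstDiff x y)) r := if_neg h

theorem Zfun_le_one {r : ℝ} (hr : 0 ≤ r) : Zfun T x y r ≤ 1 := by
  rcases eq_or_ne x y with h | h
  · exact (if_pos h).le
  · exact (Zfun_of_ne h r).trans_le (truncRatio_le_one _ hr)

theorem Zfun_mono {r s : ℝ} (hr : 0 ≤ r) (hrs : r ≤ s) : Zfun T x y r ≤ Zfun T x y s := by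
  rcases eq_or_ne x y with h | h
  · exact (if_pos h).le.trans (if_pos h).ge
  · rw [Zfun_of_ne h, Zfun_of_ne h]
    exact truncRatio_mono _ hr hrs

theorem measurable_firstDiff :
    Measurable fun p : Shift m × Shift m => PiNat.firstDiff p.1 p.2 := by
  classical
  have hex (p : Shift m × Shift m) : ∃ n, p.1 n ≠ p.2 n ∨ p.1 = p.2 := by
    by_contra! h
    exact (h 0).2 (funext fun n => (h n).1)
  have hfind (p : Shift m × Shift m) : PiNat.firstDiff p.1 p.2 = Nat.find (hex p) := by
    rw [PiNat.firstDiff_def]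
    split_ifs with h
    · simp only [h, or_false]
      congr
    · exact ((Nat.find_eq_zero _).2 (.inr (not_not.1 h))).symm
  simp only [hfind]
  refine measurable_find _ fun n => MeasurableSet.union ?_ ?_
  · exact (measurableSet_eq_fun (by fun_prop) (by fun_prop)).compl
  · exact measurableSet_eq_fun measurable_fst measurable_snd

theorem measurable_Zfun (r : ℝ) : Measurable fun p : Shift m × Shift m => Zfun T p.1 p.2 r := by
  have htrunc : Measurable fun q : Shift m × ℕ => truncRatio (prefixProd T q.1 q.2) r :=
    measurable_from_prod_countable_left fun n => measurable_comp_prefixProd (truncRatio · r) n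
  have htrunc_firstDiff := htrunc.comp (measurable_fst.prodMk measurable_firstDiff)
  exact Measurable.ite (measurableSet_eq_fun measurable_fst measurable_snd) measurable_const
    htrunc_firstDiff

theorem measurable_Gfun [SFinite μ] (r : ℝ) : Measurable fun x => Gfun T μ x r :=
  Measurable.lintegral_prod_right (measurable_Zfun r).ennreal_ofReal

theorem isMassFunction_Gfun [IsProbabilityMeasure μ] (x : Shift m) :
    IsMassFunction (Gfun T μ x) where
  monotoneOn _ hr _ _ h := lintegral_mono fun _ =>
    ENNReal.ofReal_le_ofReal (Zfun_mono (le_of_lt hr) h)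
  le_one r hr := (lintegral_mono fun _ => ENNReal.ofReal_le_one.2 (Zfun_le_one hr.le)).trans_eq
    (by simp)

variable (T μ) in
/-- The factor `Z_{x|n}(r)` times the mass of the cylinder `[x_1 ⋯ x_n]`. -/
noncomputable def cylinderWeight (x : Shift m) (n : ℕ) (r : ℝ) : ℝ≥0∞ :=
  ENNReal.ofReal (truncRatio (prefixProd T x n) r) * μ (PiNat.cylinder x n)

variable (T μ) in
/-- The largest weight of a cylinder around `x` at scale `r`. It stands between `G_μ(x,r)` and the
projected mass of `B(π^a x, r)`. -/
noncomputable def maxCylinderWeight (x : Shift m) (r : ℝ) : ℝ≥0∞ :=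
  ⨆ n, cylinderWeight T μ x n r

theorem cylinderWeight_le_maxCylinderWeight (x : Shift m) (n : ℕ) (r : ℝ) :
    cylinderWeight T μ x n r ≤ maxCylinderWeight T μ x r :=
  le_iSup (cylinderWeight T μ x · r) n

theorem isMassFunction_maxCylinderWeight [IsProbabilityMeasure μ] (x : Shift m) :
    IsMassFunction (maxCylinderWeight T μ x) where
  monotoneOn _ hr _ _ h := iSup_mono fun _ => mul_le_mul_left
    (ENNReal.ofReal_le_ofReal (truncRatio_mono _ (le_of_lt hr) h)) _
  le_one _ hr := iSup_le fun _ => mul_le_one' (ENNReal.ofReal_le_one.2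
    (truncRatio_le_one _ hr.le)) prob_le_one

variable {r : ℝ}

section SmallPrefix

variable (hT : ∀ i, (T i).det ≠ 0) {N : ℕ} (hN : opNorm (prefixProd T x N) ≤ r)
include hT hN

theorem exists_cylinderWeight_le_of_opNorm_le (n : ℕ) :
    ∃ k ≤ N, cylinderWeight T μ x n r ≤ cylinderWeight T μ x k r := by
  rcases le_total n N with h | h
  · exact ⟨n, h, le_rfl⟩
  have hr : 0 ≤ r := (norm_nonneg _).trans hN
  refine ⟨N, le_rfl, mul_le_mul' (ENNReal.ofReal_le_ofReal ?_)
    (measure_mono (PiNat.cylinder_anti x h))⟩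
  rw [truncRatio_eq_one (det_prefixProd_ne_zero hT x N) hN]
  exact truncRatio_le_one _ hr

theorem exists_mem_cylinder_Zfun_le (y : Shift m) :
    ∃ n ≤ N, y ∈ PiNat.cylinder x n ∧ Zfun T x y r ≤ truncRatio (prefixProd T x n) r := by
  by_cases hy : y ∈ PiNat.cylinder x N
  · refine ⟨N, le_rfl, hy, ?_⟩
    rw [truncRatio_eq_one (det_prefixProd_ne_zero hT x N) hN]
    exact Zfun_le_one ((norm_nonneg _).trans hN)
  · have hne : x ≠ y := fun h => hy (h ▸ PiNat.self_mem_cylinder x N)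
    refine ⟨PiNat.firstDiff x y, ?_, ?_, (Zfun_of_ne hne r).le⟩
    · by_contra! h
      exact hy (PiNat.cylinder_anti x h.le (PiNat.firstDiff_comm x y ▸
        PiNat.mem_cylinder_firstDiff y x))
    · exact PiNat.firstDiff_comm x y ▸ PiNat.mem_cylinder_firstDiff y x

theorem Gfun_le_mul_maxCylinderWeight :
    Gfun T μ x r ≤ (N + 1 : ℕ) * maxCylinderWeight T μ x r := by
  have hcyl (n : ℕ) : MeasurableSet (PiNat.cylinder x n) :=
    (PiNat.isOpen_cylinder _ x n).measurableSet
  have hZ (y : Shift m) : ENNReal.ofReal (Zfun T x y r) ≤ ∑ n ∈ Finset.range (N + 1),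
      (PiNat.cylinder x n).indicator
        (fun _ => ENNReal.ofReal (truncRatio (prefixProd T x n) r)) y := by
    obtain ⟨n, hn, hy, hle⟩ := exists_mem_cylinder_Zfun_le hT hN y
    refine le_trans ?_ (Finset.single_le_sum (fun _ _ => zero_le)
      (Finset.mem_range.2 (Nat.lt_succ_of_le hn)))
    rw [Set.indicator_of_mem hy]
    exact ENNReal.ofReal_le_ofReal hle
  calc Gfun T μ x r ≤ ∫⁻ y, ∑ n ∈ Finset.range (N + 1), (PiNat.cylinder x n).indicator
        (fun _ => ENNReal.ofReal (truncRatio (prefixProd T x n) r)) y ∂μ := lintegral_mono hZ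
    _ = ∑ n ∈ Finset.range (N + 1), cylinderWeight T μ x n r := by
      rw [lintegral_finsetSum _ fun n _ => measurable_const.indicator (hcyl n)]
      exact Finset.sum_congr rfl fun n _ => lintegral_indicator_const (hcyl n) _
    _ ≤ ∑ _n ∈ Finset.range (N + 1), maxCylinderWeight T μ x r :=
      Finset.sum_le_sum fun n _ => cylinderWeight_le_maxCylinderWeight x n r
    _ = (N + 1 : ℕ) * maxCylinderWeight T μ x r := by
      rw [Finset.sum_const, Finset.card_range, nsmul_eq_mul]

end SmallPrefix

theorem exists_forall_opNorm_prefixProd_le_dyad (hρ : contractionRatio T < 1) :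
    ∃ K : ℕ, ∀ (x : Shift m) (j : ℕ), opNorm (prefixProd T x (K * j)) ≤ dyad j := by
  obtain ⟨K, hK⟩ := exists_pow_lt_of_lt_one (by norm_num : (0 : ℝ) < 1 / 2) hρ
  refine ⟨K, fun x j => (opNorm_prefixProd_le x _).trans ?_⟩
  rw [pow_mul]
  exact pow_le_pow_left₀ (pow_nonneg (contractionRatio_nonneg T) K) hK.le j

theorem subexpLE_Gfun_maxCylinderWeight (hT : ∀ i, (T i).det ≠ 0) (hρ : contractionRatio T < 1)
    (x : Shift m) : SubexpLE (Gfun T μ x) (maxCylinderWeight T μ x) := by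
  obtain ⟨K, hK⟩ := exists_forall_opNorm_prefixProd_le_dyad hρ
  refine SubexpLE.of_le_poly_mul (C := K + 1) (p := 1) (Eventually.of_forall fun j => ?_)
  refine (Gfun_le_mul_maxCylinderWeight hT (hK x j)).trans (mul_le_mul_left ?_ _)
  rw [← ENNReal.ofReal_natCast]
  refine ENNReal.ofReal_le_ofReal ?_
  push_cast
  nlinarith [Nat.cast_nonneg (α := ℝ) K, Nat.cast_nonneg (α := ℝ) j]

theorem tendsto_singVal_prefixProd (hT : ∀ i, (T i).det ≠ 0) (hρ : contractionRatio T < 1)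
    (x : Shift m) {k : ℕ} (hk : k < d) :
    Tendsto (fun n => singVal (prefixProd T x n) k) atTop (𝓝[>] 0) :=
  tendsto_nhdsWithin_iff.2 ⟨squeeze_zero (fun _ => singVal_nonneg _ _)
    (fun n => (singVal_le_opNorm _ hk).trans (opNorm_prefixProd_le x n))
    (tendsto_pow_atTop_nhds_zero_of_lt_one (contractionRatio_nonneg T) hρ),
    Eventually.of_forall fun n => singVal_pos (det_prefixProd_ne_zero hT x n) hk⟩

variable [IsProbabilityMeasure μ]

section Sn

variable (hd : 0 < d) (hT : ∀ i, (T i).det ≠ 0) (hρ : contractionRatio T < 1) {n : ℕ} (hn : 0 < n)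
  {s : ℝ} (hs : 0 ≤ s)
include hd hT hρ hn

theorem svfExt_Sn : svfExt (Sn T μ x n) (prefixProd T x n) = μ.real (PiNat.cylinder x n) := by
  obtain ⟨t, ht, hu⟩ := existsUnique_svfExt_prefixProd hd T hT
    (fun i => (opNorm_le_contractionRatio T i).trans_lt hρ) μ x hn
  have hset : {t : ℝ≥0∞ | svfExt t (prefixProd T x n) = μ.real (PiNat.cylinder x n)} = {t} :=
    Set.eq_singleton_iff_unique_mem.2 ⟨ht, hu⟩
  rwa [Sn, hset, sInf_singleton]

omit [IsProbabilityMeasure μ] hd hT in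
theorem opNorm_prefixProd_lt_one : opNorm (prefixProd T x n) < 1 :=
  (opNorm_prefixProd_le x n).trans_lt (pow_lt_one₀ (contractionRatio_nonneg T) hρ hn.ne')

omit [IsProbabilityMeasure μ] in
theorem svf_prefixProd_antitoneOn :
    AntitoneOn (fun s => svf s (prefixProd T x n)) (Set.Ici 0) := fun s hs t ht hst => by
  have hdet := det_prefixProd_ne_zero hT x n
  simp only [svf_eq_exp hdet hs, svf_eq_exp hdet ht]
  exact Real.exp_le_exp.2
    ((logSvf_strictAntiOn hd hdet (opNorm_prefixProd_lt_one hρ hn)).antitoneOn hs ht hst)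

include hs

theorem svf_le_of_Sn_le (h : Sn T μ x n ≤ ENNReal.ofReal s) :
    svf s (prefixProd T x n) ≤ μ.real (PiNat.cylinder x n) := by
  rw [← svfExt_Sn hd hT hρ hn, svfExt, if_neg (ne_top_of_le_ne_top ENNReal.ofReal_ne_top h)]
  exact svf_prefixProd_antitoneOn hd hT hρ hn ENNReal.toReal_nonneg hs
    (ENNReal.toReal_le_of_le_ofReal hs h)

theorem le_svf_of_le_Sn (h : ENNReal.ofReal s ≤ Sn T μ x n) :
    μ.real (PiNat.cylinder x n) ≤ svf s (prefixProd T x n) := by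
  rw [← svfExt_Sn hd hT hρ hn, svfExt]
  split_ifs with htop
  · exact (Real.exp_pos _).le.trans_eq (svf_eq_exp (det_prefixProd_ne_zero hT x n) hs).symm
  · exact svf_prefixProd_antitoneOn hd hT hρ hn hs ENNReal.toReal_nonneg
      ((ENNReal.ofReal_le_iff_le_toReal htop).1 h)

end Sn

section LowerExp

variable (hd : 0 < d) (hT : ∀ i, (T i).det ≠ 0) (hρ : contractionRatio T < 1) {s : ℝ} (hs : 0 ≤ s)
  (hsd : s < d)

theorem lowerExp_maxCylinderWeight_le_dim (x : Shift m) :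
    lowerExp (maxCylinderWeight T μ x) ≤ ((d : ℝ) : EReal) := by
  refine liminf_le_of_frequently_le (Eventually.frequently ?_) (by isBoundedDefault)
  filter_upwards [Ioo_mem_nhdsGT zero_lt_one] with r hr
  rw [logRatio_le_iff hr.1 hr.2]
  refine le_trans ?_ (cylinderWeight_le_maxCylinderWeight x 0 r)
  rw [cylinderWeight, PiNat.cylinder_zero, measure_univ, mul_one, Real.rpow_natCast]
  refine ENNReal.ofReal_le_ofReal (pow_le_truncRatio ?_ ?_ hr.1.le hr.2.le)
  · simp [prefixProd]
  · simpa using opNorm_prefixProd_le (T := T) x 0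

include hd hT hρ hs hsd

-- At scale `r = α_{⌊s⌋ + 1}(T_{x|n})` the identity `Z_{x|n}(r) φ^s(T_{x|n}) = r ^ s` is exact.
theorem lowerExp_maxCylinderWeight_le_of_Sloc_lt (h : Sloc T μ x < ENNReal.ofReal s) :
    lowerExp (maxCylinderWeight T μ x) ≤ (s : EReal) := by
  have hk : ⌊s⌋₊ < d := (Nat.floor_lt hs).2 hsd
  have hscale := tendsto_singVal_prefixProd hT hρ x hk
  have hfreq : ∃ᶠ n in atTop, Sn T μ x n < ENNReal.ofReal s :=
    frequently_lt_of_liminf_lt (by isBoundedDefault) h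
  refine liminf_le_of_frequently_le (hscale.frequently ((hfreq.and_eventually
    ((eventually_gt_atTop 0).and (hscale.eventually (Ioo_mem_nhdsGT zero_lt_one)))).mono ?_))
    (by isBoundedDefault)
  rintro n ⟨hSn, hn, hr0, hr1⟩
  rw [logRatio_le_iff hr0 hr1]
  refine le_trans ?_ (cylinderWeight_le_maxCylinderWeight x n _)
  rw [← truncRatio_singVal_floor_mul_svf (det_prefixProd_ne_zero hT x n) hs hsd,
    ENNReal.ofReal_mul (truncRatio_nonneg _ hr0.le), cylinderWeight, ← ofReal_measureReal]
  gcongr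
  exact svf_le_of_Sn_le hd hT hρ hn hs hSn.le

theorem le_lowerExp_maxCylinderWeight_of_lt_Sloc (h : ENNReal.ofReal s < Sloc T μ x) :
    (s : EReal) ≤ lowerExp (maxCylinderWeight T μ x) := by
  obtain ⟨N, hN⟩ := eventually_atTop.1 ((eventually_lt_of_lt_liminf h).and
    (eventually_gt_atTop 0))
  have hinit : ∀ᶠ r in 𝓝[>] (0 : ℝ), ∀ n < N, truncRatio (prefixProd T x n) r ≤ r ^ s :=
    (eventually_all_finite (Set.finite_Iio N)).2 fun n _ =>
      eventually_truncRatio_le_rpow (det_prefixProd_ne_zero hT x n) hsd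
  refine le_liminf_of_le (by isBoundedDefault) ?_
  filter_upwards [hinit, Ioo_mem_nhdsGT zero_lt_one] with r hinit hr
  rw [le_logRatio_iff hr.1 hr.2]
  refine iSup_le fun n => ?_
  rcases lt_or_ge n N with hn | hn
  · exact (mul_le_of_le_one_right zero_le prob_le_one).trans
      (ENNReal.ofReal_le_ofReal (hinit n hn))
  · obtain ⟨hSn, hn0⟩ := hN n hn
    have htrunc := truncRatio_nonneg (prefixProd T x n) hr.1.le
    rw [cylinderWeight, ← ofReal_measureReal, ← ENNReal.ofReal_mul htrunc]
    refine ENNReal.ofReal_le_ofReal ((mul_le_mul_of_nonneg_left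
      (le_svf_of_le_Sn hd hT hρ hn0 hs hSn.le) htrunc).trans ?_)
    exact truncRatio_mul_svf_le (det_prefixProd_ne_zero hT x n) hr.1.le hs hsd

end LowerExp

theorem lowerExp_maxCylinderWeight (hd : 0 < d) (hT : ∀ i, (T i).det ≠ 0)
    (hρ : contractionRatio T < 1) (x : Shift m) :
    lowerExp (maxCylinderWeight T μ x) = ((min (Sloc T μ x) (d : ℝ≥0∞) : ℝ≥0∞) : EReal) := by
  have hcoe {s : ℝ} (hs : 0 ≤ s) : ((ENNReal.ofReal s : ℝ≥0∞) : EReal) = s := by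
    rw [EReal.coe_ennreal_ofReal, max_eq_left hs]
  have hdim : ((d : ℝ≥0∞) : EReal) = (d : ℝ) := by
    rw [← hcoe (Nat.cast_nonneg d), ENNReal.ofReal_natCast]
  rw [EReal.coe_ennreal_strictMono.monotone.map_min, hdim]
  refine le_antisymm (le_min ?_ (lowerExp_maxCylinderWeight_le_dim x)) ?_
  · refine EReal.le_of_forall_lt_iff_le.1 fun s hs => ?_
    have hs0 : 0 ≤ s := by exact_mod_cast ((EReal.coe_ennreal_nonneg _).trans_lt hs).le
    rcases lt_or_ge s d with hsd | hsd
    · rw [← hcoe hs0, EReal.coe_ennreal_lt_coe_ennreal_iff] at hs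
      exact lowerExp_maxCylinderWeight_le_of_Sloc_lt hd hT hρ hs0 hsd hs
    · exact (lowerExp_maxCylinderWeight_le_dim x).trans (by exact_mod_cast hsd)
  · refine EReal.ge_of_forall_gt_iff_ge.1 fun s hs => ?_
    obtain ⟨hS, hsd⟩ := lt_min_iff.1 hs
    rcases le_or_gt 0 s with hs0 | hs0
    · rw [← hcoe hs0, EReal.coe_ennreal_lt_coe_ennreal_iff] at hS
      exact le_lowerExp_maxCylinderWeight_of_lt_Sloc hd hT hρ hs0 (by exact_mod_cast hsd) hS
    · refine le_liminf_of_le (by isBoundedDefault) ?_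
      filter_upwards [Ioo_mem_nhdsGT zero_lt_one] with r hr
      rw [le_logRatio_iff hr.1 hr.2]
      exact ((isMassFunction_maxCylinderWeight x).le_one r hr.1).trans (ENNReal.one_le_ofReal.2
        (Real.one_le_rpow_of_pos_of_le_one_of_nonpos hr.1 hr.2.le hs0.le))

end Weights

/-! ### Projected balls -/

section ProjBall

variable {m d : ℕ} (T : Fin m → Matrix (Fin d) (Fin d) ℝ) (μ : Measure (Shift m))

/-- The mass of the ball of radius `r` around `π^a x` under the projection `π^a_* μ`. -/
noncomputable def projBall (a : Fin m → Euc d) (x : Shift m) (r : ℝ) : ℝ≥0∞ :=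
  projMeasure T a μ (Metric.closedBall (codingMap T a x) r)

variable {T} {μ} (hρ : contractionRatio T < 1)
include hρ

theorem projBall_eq (a : Fin m → Euc d) (x : Shift m) (r : ℝ) :
    projBall T μ a x r = μ {y | ‖codingMap T a x - codingMap T a y‖ ≤ r} := by
  rw [projBall, projMeasure, Measure.map_apply (measurable_codingMap hρ a)
    Metric.isClosed_closedBall.measurableSet]
  congr 1
  ext y
  rw [Set.mem_preimage, Metric.mem_closedBall', dist_eq_norm]
  rfl

theorem measure_cylinder_inter_projBall_lt_le {a : Fin m → Euc d} {R : ℝ}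
    (haR : ∀ x, ‖codingMap T a x‖ ≤ R) (n : ℕ) {r : ℝ} (hr : 0 < r) (c : ℝ≥0∞) (x : Shift m) :
    μ ({y | projBall T μ a y r < c * cylinderWeight T μ y n r} ∩ PiNat.cylinder x n) ≤
      ENNReal.ofReal ((2 * R * √d + 2) ^ d) * c * μ (PiNat.cylinder x n) := by
  have hR : 0 ≤ R := (norm_nonneg _).trans (haR x)
  -- Points of the cylinder whose shifts project to the same cell are `r`-close under `π^a`.
  have hcell : ∀ y ∈ {y | projBall T μ a y r < c * cylinderWeight T μ y n r} ∩ PiNat.cylinder x n,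
      μ ({y | projBall T μ a y r < c * cylinderWeight T μ y n r} ∩ PiNat.cylinder x n ∩
        (fun z => cellIndex (prefixProd T x n) r (codingMap T a (shiftBy n z))) ⁻¹'
          {cellIndex (prefixProd T x n) r (codingMap T a (shiftBy n y))}) ≤
        c * cylinderWeight T μ x n r := by
    rintro y ⟨hy, hyx⟩
    calc _ ≤ projBall T μ a y r := by
          rw [projBall_eq hρ]
          refine measure_mono ?_
          rintro z ⟨⟨-, hzx⟩, hz⟩
          have hzy : z ∈ PiNat.cylinder y n := PiNat.mem_cylinder_iff_eq.1 hyx ▸ hzx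
          rw [Set.mem_ofPred_eq, codingMap_sub hρ a hzy, prefixProd_congr hyx]
          exact norm_toOp_sub_le_of_cellIndex_eq _ hr (Set.mem_singleton_iff.1 hz).symm
      _ ≤ c * cylinderWeight T μ y n r := le_of_lt hy
      _ = c * cylinderWeight T μ x n r := by
          rw [cylinderWeight, cylinderWeight, prefixProd_congr hyx,
            PiNat.mem_cylinder_iff_eq.1 hyx]
  refine (measure_le_card_mul (F := cellWindow (prefixProd T x n) r R)
    (fun y _ => cellIndex_mem_cellWindow _ hr.le (haR _)) hcell).trans ?_
  calc _ = ENNReal.ofReal ((cellWindow (prefixProd T x n) r R).card *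
          truncRatio (prefixProd T x n) r) * c * μ (PiNat.cylinder x n) := by
        rw [ENNReal.ofReal_mul (Nat.cast_nonneg _), ENNReal.ofReal_natCast, cylinderWeight]
        ring
    _ ≤ _ := by
        gcongr
        exact card_cellWindow_mul_truncRatio_le _ hr.le hR

theorem measure_projBall_lt_mul_cylinderWeight_le [IsProbabilityMeasure μ] {a : Fin m → Euc d}
    {R : ℝ} (haR : ∀ x, ‖codingMap T a x‖ ≤ R) (n : ℕ) {r : ℝ} (hr : 0 < r) (c : ℝ≥0∞) :
    μ {x | projBall T μ a x r < c * cylinderWeight T μ x n r} ≤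
      ENNReal.ofReal ((2 * R * √d + 2) ^ d) * c := by
  have hrestrict : Measurable fun (y : Shift m) (i : Fin n) => y i :=
    measurable_pi_lambda _ fun i => measurable_pi_apply _
  have hcyl (x : Shift m) :
      (fun (y : Shift m) (i : Fin n) => y i) ⁻¹' {fun i : Fin n => x i} = PiNat.cylinder x n := by
    ext y
    simp only [PiNat.mem_cylinder_iff, Set.mem_preimage, Set.mem_singleton_iff, funext_iff,
      Fin.forall_iff]
  refine (measure_le_mul_of_forall_fiber_le hrestrict fun x => ?_).trans
    (by rw [measure_univ, mul_one])
  rw [hcyl]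
  exact measure_cylinder_inter_projBall_lt_le hρ haR n hr c x

theorem measure_projBall_lt_mul_maxCylinderWeight_le [IsProbabilityMeasure μ]
    (hT : ∀ i, (T i).det ≠ 0) {a : Fin m → Euc d} {R : ℝ} (haR : ∀ x, ‖codingMap T a x‖ ≤ R)
    {N : ℕ} {r : ℝ} (hr : 0 < r) (hN : ∀ x, opNorm (prefixProd T x N) ≤ r) (c : ℝ≥0∞) :
    μ {x | projBall T μ a x r < c * maxCylinderWeight T μ x r} ≤
      (N + 1 : ℕ) * (ENNReal.ofReal ((2 * R * √d + 2) ^ d) * c) := by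
  have hsub : {x | projBall T μ a x r < c * maxCylinderWeight T μ x r} ⊆
      ⋃ n ∈ Finset.range (N + 1), {x | projBall T μ a x r < c * cylinderWeight T μ x n r} := by
    intro x hx
    rw [Set.mem_ofPred_eq, maxCylinderWeight, ENNReal.mul_iSup, lt_iSup_iff] at hx
    obtain ⟨n, hn⟩ := hx
    obtain ⟨k, hk, hle⟩ := exists_cylinderWeight_le_of_opNorm_le (μ := μ) hT (hN x) n
    exact Set.mem_iUnion₂.2 ⟨k, Finset.mem_range.2 (Nat.lt_succ_of_le hk), hn.trans_le (by gcongr)⟩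
  calc _ ≤ ∑ n ∈ Finset.range (N + 1), μ {x | projBall T μ a x r <
        c * cylinderWeight T μ x n r} := (measure_mono hsub).trans (measure_biUnion_finset_le _ _)
    _ ≤ ∑ _n ∈ Finset.range (N + 1), ENNReal.ofReal ((2 * R * √d + 2) ^ d) * c :=
      Finset.sum_le_sum fun n _ => measure_projBall_lt_mul_cylinderWeight_le hρ haR n hr c
    _ = _ := by rw [Finset.sum_const, Finset.card_range, nsmul_eq_mul]

theorem ae_subexpLE_maxCylinderWeight_projBall [IsProbabilityMeasure μ]
    (hT : ∀ i, (T i).det ≠ 0) (a : Fin m → Euc d) :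
    ∀ᵐ x ∂μ, SubexpLE (maxCylinderWeight T μ x) (projBall T μ a x) := by
  obtain ⟨K, hK⟩ := exists_forall_opNorm_prefixProd_le_dyad hρ
  set C := ENNReal.ofReal ((2 * ((1 - contractionRatio T)⁻¹ * ‖a‖) * √d + 2) ^ d)
  refine ae_subexpLE_of_measure_lt_mul_le (C := (K + 1 : ℕ) * C) (p := 1)
    (ENNReal.mul_ne_top (ENNReal.natCast_ne_top _) ENNReal.ofReal_ne_top) fun j c => ?_
  refine (measure_projBall_lt_mul_maxCylinderWeight_le hρ hT (norm_codingMap_le hρ a) (dyad_pos j)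
    (fun x => hK x j) c).trans ?_
  have hcount : K * j + 1 ≤ (K + 1) * (j + 1) := by nlinarith
  calc ((K * j + 1 : ℕ) : ℝ≥0∞) * (C * c)
      ≤ (((K + 1) * (j + 1) : ℕ) : ℝ≥0∞) * (C * c) := by gcongr
    _ = _ := by
      push_cast
      ring

end ProjBall

/-! ### Transversality -/

section Transversality

variable {m d : ℕ} {T : Fin m → Matrix (Fin d) (Fin d) ℝ}

/-- The total weight, in powers of the contraction ratio, of the occurrences of the letter `i`
in `x` after the first symbol; it bounds the dependence of `π^a x` on `a_i` through them. -/
noncomputable def tailWeight (T : Fin m → Matrix (Fin d) (Fin d) ℝ) (x : Shift m) (i : Fin m) : ℝ :=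
  ∑' k, if x (k + 1) = i then contractionRatio T ^ (k + 1) else 0

variable (hρ : contractionRatio T < 1)
include hρ

theorem summable_tailWeight (x : Shift m) (i : Fin m) :
    Summable fun k => if x (k + 1) = i then contractionRatio T ^ (k + 1) else 0 := by
  have h0 := contractionRatio_nonneg T
  refine Summable.of_nonneg_of_le (fun k => by positivity) (fun k => ?_)
    ((summable_nat_add_iff 1).2 (summable_geometric_of_lt_one h0 hρ))
  split_ifs
  exacts [le_rfl, by positivity]

theorem tailWeight_add_le (x : Shift m) {i j : Fin m} (hij : i ≠ j) :
    tailWeight T x i + tailWeight T x j ≤ contractionRatio T / (1 - contractionRatio T) := by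
  have h0 := contractionRatio_nonneg T
  have hgeom : HasSum (fun k => contractionRatio T ^ (k + 1))
      (contractionRatio T / (1 - contractionRatio T)) := by
    simpa only [pow_succ', div_eq_mul_inv] using
      (hasSum_geometric_of_lt_one h0 hρ).mul_left (contractionRatio T)
  refine hasSum_le (fun k => ?_) ((summable_tailWeight hρ x i).hasSum.add
    (summable_tailWeight hρ x j).hasSum) hgeom
  have hk : 0 ≤ contractionRatio T ^ (k + 1) := by positivity
  by_cases hi : x (k + 1) = i
  · simp [hi, hij]
  · by_cases hj : x (k + 1) = j <;> simp [hi, hj, hk, hij.symm]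

theorem codingMap_add (a b : Fin m → Euc d) (x : Shift m) :
    codingMap T (a + b) x = codingMap T a x + codingMap T b x := by
  simp only [codingMap_eq_tsum hρ, Pi.add_apply, map_add]
  exact (summable_toOp_prefixProd_apply hρ a x).tsum_add (summable_toOp_prefixProd_apply hρ b x)

theorem codingMap_smul (c : ℝ) (a : Fin m → Euc d) (x : Shift m) :
    codingMap T (c • a) x = c • codingMap T a x := by
  simp only [codingMap_eq_tsum hρ, Pi.smul_apply, map_smul]
  exact (summable_toOp_prefixProd_apply hρ a x).tsum_const_smul c

theorem norm_codingMap_single_sub_le (x : Shift m) (i : Fin m) (u : Euc d) :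
    ‖codingMap T (Pi.single i u) x - Pi.single (M := fun _ => Euc d) i u (x 0)‖ ≤
      tailWeight T x i * ‖u‖ := by
  have hsum := summable_toOp_prefixProd_apply hρ (Pi.single i u) x
  have hhead : toOp (prefixProd T x 0) (Pi.single (M := fun _ => Euc d) i u (x 0)) =
      Pi.single (M := fun _ => Euc d) i u (x 0) := by simp [prefixProd]
  rw [codingMap_eq_tsum hρ, hsum.tsum_eq_zero_add, hhead, add_sub_cancel_left]
  refine tsum_of_norm_bounded ((summable_tailWeight hρ x i).hasSum.mul_right ‖u‖) fun k => ?_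
  split_ifs with h
  · rw [h, Pi.single_eq_same]
    exact norm_toOp_prefixProd_apply_le x (k + 1) u
  · simp [Pi.single_eq_of_ne h]

theorem one_sub_tailWeight_mul_norm_le {x y : Shift m} (hxy : x 0 ≠ y 0) (u : Euc d) :
    (1 - (tailWeight T x (x 0) + tailWeight T y (x 0))) * ‖u‖ ≤
      ‖codingMap T (Pi.single (x 0) u) x - codingMap T (Pi.single (x 0) u) y‖ := by
  have hx := norm_codingMap_single_sub_le hρ x (x 0) u
  have hy := norm_codingMap_single_sub_le hρ y (x 0) u
  rw [Pi.single_eq_same] at hx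
  rw [Pi.single_eq_of_ne hxy.symm, sub_zero] at hy
  have htri := norm_add₃_le (a := u - codingMap T (Pi.single (x 0) u) x)
    (b := codingMap T (Pi.single (x 0) u) x - codingMap T (Pi.single (x 0) u) y)
    (c := codingMap T (Pi.single (x 0) u) y)
  rw [norm_sub_rev u, sub_add_sub_cancel, sub_add_cancel] at htri
  linarith

theorem exists_letter_expanding {x y : Shift m} (hxy : x 0 ≠ y 0) :
    ∃ i, ∀ u, (1 - contractionRatio T / (1 - contractionRatio T)) * ‖u‖ ≤
      ‖codingMap T (Pi.single i u) x - codingMap T (Pi.single i u) y‖ := by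
  have hx := tailWeight_add_le hρ x hxy
  have hy := tailWeight_add_le hρ y hxy
  rcases le_total (tailWeight T x (x 0) + tailWeight T y (x 0))
    (tailWeight T y (y 0) + tailWeight T x (y 0)) with h | h
  · refine ⟨x 0, fun u => le_trans ?_ (one_sub_tailWeight_mul_norm_le hρ hxy u)⟩
    gcongr
    linarith
  · refine ⟨y 0, fun u => le_trans ?_
      ((one_sub_tailWeight_mul_norm_le hρ hxy.symm u).trans_eq (norm_sub_rev _ _))⟩
    gcongr
    linarith

theorem volume_setOf_codingMap_update_le (hT : ∀ i, (T i).det ≠ 0) {x y : Shift m} {n : ℕ}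
    (hxy : y ∈ PiNat.cylinder x n) {i : Fin m} {κ : ℝ} (hκ : 0 < κ)
    (hi : ∀ u, κ * ‖u‖ ≤ ‖codingMap T (Pi.single i u) (shiftBy n x) -
      codingMap T (Pi.single i u) (shiftBy n y)‖) (R : ℝ) {r : ℝ} (hr : 0 ≤ r)
    (a : Fin m → Euc d) :
    volume {u | ‖Function.update a i u‖ ≤ R ∧ ‖codingMap T (Function.update a i u) x -
        codingMap T (Function.update a i u) y‖ ≤ r} ≤
      ENNReal.ofReal (κ⁻¹ ^ d) * ENNReal.ofReal
        ((2 * max 1 (2 * ((1 - contractionRatio T)⁻¹ * R))) ^ d *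
          truncRatio (prefixProd T x n) r) := by
  let Δ : (Fin m → Euc d) →ₗ[ℝ] Euc d :=
    { toFun := fun a => codingMap T a (shiftBy n x) - codingMap T a (shiftBy n y)
      map_add' := fun a b => by rw [codingMap_add hρ, codingMap_add hρ]; abel
      map_smul' := fun c a => by rw [codingMap_smul hρ, codingMap_smul hρ, smul_sub]; rfl }
  have hΔ : ∀ u, Δ (Function.update a i u) =
      (Δ ∘ₗ LinearMap.single ℝ (fun _ => Euc d) i) u + Δ (Function.update a i 0) := fun u => by
    rw [LinearMap.comp_apply, LinearMap.single_apply, ← map_add]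
    congr 1
    ext j : 1
    rcases eq_or_ne j i with rfl | hj <;> simp [*]
  have hΔ_norm : ∀ b, ‖Δ b‖ ≤ 2 * ((1 - contractionRatio T)⁻¹ * ‖b‖) := fun b =>
    (norm_sub_le_of_le (norm_codingMap_le hρ b _) (norm_codingMap_le hρ b _)).trans_eq
      (two_mul _).symm
  have hinv : 0 ≤ (1 - contractionRatio T)⁻¹ := inv_nonneg.2 (sub_nonneg.2 hρ.le)
  have hpre := addHaar_preimage_linearMap_add_le volume hκ
    (L := Δ ∘ₗ LinearMap.single ℝ (fun _ => Euc d) i) hi (Δ (Function.update a i 0))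
    {v | ‖v‖ ≤ max 1 (2 * ((1 - contractionRatio T)⁻¹ * R)) ∧ ‖toOp (prefixProd T x n) v‖ ≤ r}
  rw [finrank_euclideanSpace_fin] at hpre
  refine ((measure_mono ?_).trans hpre).trans (mul_le_mul_right
    (volume_closedBall_inter_preimage_closedBall_le (det_prefixProd_ne_zero hT x n)
      (le_max_left _ _) hr) _)
  rintro u ⟨huR, hur⟩
  rw [codingMap_sub hρ _ hxy] at hur
  change _ ∧ _
  rw [← hΔ]
  refine ⟨(hΔ_norm _).trans (le_max_of_le_right ?_), hur⟩
  exact mul_le_mul_of_nonneg_left (mul_le_mul_of_nonneg_left huR hinv) zero_le_two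

theorem restrict_setOf_codingMap_sub_le (hT : ∀ i, (T i).det ≠ 0) {x y : Shift m} {n : ℕ}
    (hxy : y ∈ PiNat.cylinder x n) {i : Fin m} {κ : ℝ} (hκ : 0 < κ)
    (hi : ∀ u, κ * ‖u‖ ≤ ‖codingMap T (Pi.single i u) (shiftBy n x) -
      codingMap T (Pi.single i u) (shiftBy n y)‖) {R r : ℝ} (hR : 0 ≤ R) (hr : 0 ≤ r) :
    volume.restrict (Metric.closedBall 0 R) {a | ‖codingMap T a x - codingMap T a y‖ ≤ r} ≤
      ENNReal.ofReal (κ⁻¹ ^ d) * ENNReal.ofReal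
        ((2 * max 1 (2 * ((1 - contractionRatio T)⁻¹ * R))) ^ d *
          truncRatio (prefixProd T x n) r) *
        volume (Metric.closedBall (0 : Euc d) R) ^ (m - 1) := by
  have hcod (z : Shift m) : Measurable fun a => codingMap T a z :=
    Measurable.of_uncurry_right (f := codingMap T) (measurable_codingMap_uncurry hρ)
  have hS : MeasurableSet {a : Fin m → Euc d |
      ‖a‖ ≤ R ∧ ‖codingMap T a x - codingMap T a y‖ ≤ r} :=
    (measurableSet_le measurable_norm measurable_const).inter
      (measurableSet_le ((hcod x).sub (hcod y)).norm measurable_const)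
  have hpi : volume.restrict (Metric.closedBall (0 : Fin m → Euc d) R) =
      Measure.pi fun _ => volume.restrict (Metric.closedBall (0 : Euc d) R) := by
    rw [closedBall_pi _ hR]
    exact Measure.restrict_pi_pi _ _
  calc volume.restrict (Metric.closedBall 0 R) {a | ‖codingMap T a x - codingMap T a y‖ ≤ r}
      ≤ volume.restrict (Metric.closedBall 0 R)
          {a | ‖a‖ ≤ R ∧ ‖codingMap T a x - codingMap T a y‖ ≤ r} := by
        rw [Measure.restrict_apply' Metric.isClosed_closedBall.measurableSet,
          Measure.restrict_apply' Metric.isClosed_closedBall.measurableSet]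
        exact measure_mono fun a ha => ⟨⟨mem_closedBall_zero_iff.1 ha.2, ha.1⟩, ha.2⟩
    _ ≤ _ := by
        rw [hpi]
        refine (measure_pi_le_of_forall_update _ hS i fun a =>
          (Measure.restrict_apply_le _ _).trans
            (volume_setOf_codingMap_update_le hρ hT hxy hκ hi R hr a)).trans_eq ?_
        simp

omit hρ in
theorem exists_restrict_setOf_codingMap_sub_le (hρ : contractionRatio T < 1 / 2)
    (hT : ∀ i, (T i).det ≠ 0) {R : ℝ} (hR : 0 ≤ R) :
    ∃ C : ℝ≥0∞, C ≠ ∞ ∧ ∀ (x y : Shift m) (r : ℝ), 0 ≤ r →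
      volume.restrict (Metric.closedBall 0 R) {a | ‖codingMap T a x - codingMap T a y‖ ≤ r} ≤
        C * ENNReal.ofReal (Zfun T x y r) := by
  have hρ1 : contractionRatio T < 1 := hρ.trans one_half_lt_one
  set κ := 1 - contractionRatio T / (1 - contractionRatio T)
  have hκ : 0 < κ := sub_pos.2 ((div_lt_one (sub_pos.2 hρ1)).2 (by linarith))
  set R' := 2 * max 1 (2 * ((1 - contractionRatio T)⁻¹ * R))
  set C := ENNReal.ofReal (κ⁻¹ ^ d) * ENNReal.ofReal (R' ^ d) *
    volume (Metric.closedBall (0 : Euc d) R) ^ (m - 1) with hC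
  refine ⟨C + volume (Metric.closedBall (0 : Fin m → Euc d) R), ENNReal.add_ne_top.2
    ⟨ENNReal.mul_ne_top (by finiteness) (ENNReal.pow_ne_top measure_closedBall_lt_top.ne),
      measure_closedBall_lt_top.ne⟩, fun x y r hr => ?_⟩
  rcases eq_or_ne x y with rfl | hne
  · calc _ ≤ volume (Metric.closedBall (0 : Fin m → Euc d) R) :=
          (measure_mono (Set.subset_univ _)).trans_eq (Measure.restrict_apply_univ _)
      _ ≤ (C + volume (Metric.closedBall (0 : Fin m → Euc d) R)) *
          ENNReal.ofReal (Zfun T x x r) := by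
          rw [Zfun, if_pos rfl, ENNReal.ofReal_one, mul_one]
          exact le_add_self
  · obtain ⟨i, hi⟩ := exists_letter_expanding hρ1
      (x := shiftBy (PiNat.firstDiff x y) x) (y := shiftBy (PiNat.firstDiff x y) y)
      (PiNat.apply_firstDiff_ne hne)
    calc _ ≤ C * ENNReal.ofReal (Zfun T x y r) := by
          refine (restrict_setOf_codingMap_sub_le hρ1 hT
            (fun k hk => (PiNat.apply_eq_of_lt_firstDiff hk).symm) hκ hi hR hr).trans_eq ?_
          rw [Zfun_of_ne hne, ENNReal.ofReal_mul (by positivity), hC]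
          ring
      _ ≤ _ := by
          gcongr
          exact le_self_add

end Transversality

section AlmostEveryTranslation

variable {m d : ℕ} {T : Fin m → Matrix (Fin d) (Fin d) ℝ} {μ : Measure (Shift m)}

theorem measurable_projBall [SFinite μ] (hρ : contractionRatio T < 1) (r : ℝ) :
    Measurable fun p : (Fin m → Euc d) × Shift m => projBall T μ p.1 p.2 r := by
  have hcod := measurable_codingMap_uncurry (d := d) hρ
  have hfst_snd : Measurable fun q : ((Fin m → Euc d) × Shift m) × Shift m => (q.1.1, q.2) := by
    fun_prop
  simp only [projBall_eq hρ]
  exact measurable_measure_prodMk_left (ν := μ) (s := {q : ((Fin m → Euc d) × Shift m) × Shift m |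
      ‖codingMap T q.1.1 q.1.2 - codingMap T q.1.1 q.2‖ ≤ r})
    (measurableSet_le ((hcod.comp measurable_fst).sub (hcod.comp hfst_snd)).norm measurable_const)

theorem lintegral_projBall_le [SFinite μ] (hρ : contractionRatio T < 1)
    {ν : Measure (Fin m → Euc d)} [SFinite ν] {C : ℝ≥0∞} (hC : C ≠ ∞) {x : Shift m} {r : ℝ}
    (h : ∀ y, ν {a | ‖codingMap T a x - codingMap T a y‖ ≤ r} ≤
      C * ENNReal.ofReal (Zfun T x y r)) :
    ∫⁻ a, projBall T μ a x r ∂ν ≤ C * Gfun T μ x r := by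
  have hcod := measurable_codingMap_uncurry (d := d) hρ
  have hfst_x : Measurable fun q : (Fin m → Euc d) × Shift m => (q.1, x) := by fun_prop
  have hS : MeasurableSet {q : (Fin m → Euc d) × Shift m |
      ‖codingMap T q.1 x - codingMap T q.1 q.2‖ ≤ r} :=
    measurableSet_le ((hcod.comp hfst_x).sub hcod).norm measurable_const
  calc ∫⁻ a, projBall T μ a x r ∂ν
      = (ν.prod μ) {q | ‖codingMap T q.1 x - codingMap T q.1 q.2‖ ≤ r} := by
        simp only [projBall_eq hρ]
        exact (Measure.prod_apply hS).symm
    _ = ∫⁻ y, ν {a | ‖codingMap T a x - codingMap T a y‖ ≤ r} ∂μ := Measure.prod_apply_symm hS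
    _ ≤ ∫⁻ y, C * ENNReal.ofReal (Zfun T x y r) ∂μ := lintegral_mono h
    _ = C * Gfun T μ x r := lintegral_const_mul' _ _ hC

variable [IsProbabilityMeasure μ]

theorem ae_restrict_ae_subexpLE_projBall_Gfun (hρ : contractionRatio T < 1 / 2)
    (hT : ∀ i, (T i).det ≠ 0) {R : ℝ} (hR : 0 ≤ R) :
    ∀ᵐ a ∂volume.restrict (Metric.closedBall (0 : Fin m → Euc d) R), ∀ᵐ x ∂μ,
      SubexpLE (projBall T μ a x) (Gfun T μ x) := by
  have hρ1 : contractionRatio T < 1 := hρ.trans one_half_lt_one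
  obtain ⟨C, hC, htrans⟩ := exists_restrict_setOf_codingMap_sub_le hρ hT hR
  refine Measure.ae_ae_of_ae_prod (ae_subexpLE_of_measure_lt_mul_le hC (p := 0)
    (u := fun q : (Fin m → Euc d) × Shift m => projBall T μ q.1 q.2)
    (v := fun q => Gfun T μ q.2) fun j c => ?_)
  have hball := measurable_projBall (μ := μ) hρ1 (dyad j)
  have hball_left (x : Shift m) : Measurable fun a => projBall T μ a x (dyad j) :=
    Measurable.of_uncurry_right (f := fun a x => projBall T μ a x (dyad j)) hball
  have hG : Measurable fun q : (Fin m → Euc d) × Shift m => Gfun T μ q.2 (dyad j) :=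
    (measurable_Gfun (dyad j)).comp measurable_snd
  rw [Measure.prod_apply_symm (measurableSet_lt hG (hball.const_mul c))]
  calc _ ≤ ∫⁻ _, C * c ∂μ := lintegral_mono fun x =>
        measure_lt_mul_le_of_lintegral_le (hball_left x).aemeasurable
          (lintegral_projBall_le hρ1 hC fun y => htrans x y (dyad j) (dyad_pos j).le) c
    _ = C * (j + 1) ^ 0 * c := by simp

theorem ae_ae_subexpLE_projBall_Gfun (hρ : contractionRatio T < 1 / 2)
    (hT : ∀ i, (T i).det ≠ 0) :
    ∀ᵐ a : Fin m → Euc d, ∀ᵐ x ∂μ, SubexpLE (projBall T μ a x) (Gfun T μ x) := by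
  rw [← Measure.restrict_univ (μ := volume), ← Metric.iUnion_closedBall_nat (0 : Fin m → Euc d),
    ae_restrict_iUnion_iff]
  exact fun N => ae_restrict_ae_subexpLE_projBall_Gfun hρ hT N.cast_nonneg

end AlmostEveryTranslation

/-! ### Dimensions of the projections -/

section Dimensions

variable {m d : ℕ} {T : Fin m → Matrix (Fin d) (Fin d) ℝ} {μ : Measure (Shift m)}
  [IsProbabilityMeasure μ]

theorem isProbabilityMeasure_projMeasure (hρ : contractionRatio T < 1) (a : Fin m → Euc d) :
    IsProbabilityMeasure (projMeasure T a μ) :=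
  Measure.isProbabilityMeasure_map (measurable_codingMap hρ a).aemeasurable

theorem isMassFunction_projBall (hρ : contractionRatio T < 1) (a : Fin m → Euc d) (x : Shift m) :
    IsMassFunction (projBall T μ a x) :=
  have := isProbabilityMeasure_projMeasure (μ := μ) hρ a
  isMassFunction_measure_closedBall _ _

theorem ae_locDim_le (hd : 0 < d) (hT : ∀ i, (T i).det ≠ 0) (hρ : contractionRatio T < 1)
    (a : Fin m → Euc d) :
    ∀ᵐ x ∂μ,
      lowerLocDim (projMeasure T a μ) (codingMap T a x) ≤
          ((min (Sloc T μ x) (d : ℝ≥0∞) : ℝ≥0∞) : EReal) ∧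
        upperLocDim (projMeasure T a μ) (codingMap T a x) ≤ Dloc T μ x := by
  filter_upwards [ae_subexpLE_maxCylinderWeight_projBall hρ hT a] with x hx
  have hball := isMassFunction_projBall (μ := μ) hρ a x
  have hW := isMassFunction_maxCylinderWeight (T := T) (μ := μ) x
  have hG := isMassFunction_Gfun (T := T) (μ := μ) x
  rw [← lowerExp_maxCylinderWeight hd hT hρ x]
  exact ⟨hx.lowerExp_le hW hball, ((subexpLE_Gfun_maxCylinderWeight hT hρ x).trans hx).upperExp_le
    hG hball⟩

theorem le_locDim_of_subexpLE (hd : 0 < d) (hT : ∀ i, (T i).det ≠ 0)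
    (hρ : contractionRatio T < 1) {a : Fin m → Euc d} {x : Shift m}
    (h : SubexpLE (projBall T μ a x) (Gfun T μ x)) :
    ((min (Sloc T μ x) (d : ℝ≥0∞) : ℝ≥0∞) : EReal) ≤
        lowerLocDim (projMeasure T a μ) (codingMap T a x) ∧
      Dloc T μ x ≤ upperLocDim (projMeasure T a μ) (codingMap T a x) := by
  have hball := isMassFunction_projBall (μ := μ) hρ a x
  have hW := isMassFunction_maxCylinderWeight (T := T) (μ := μ) x
  have hG := isMassFunction_Gfun (T := T) (μ := μ) x
  rw [← lowerExp_maxCylinderWeight hd hT hρ x]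
  exact ⟨(h.trans (subexpLE_Gfun_maxCylinderWeight hT hρ x)).lowerExp_le hball hW,
    h.upperExp_le hball hG⟩

theorem ae_ae_locDim_eq (hd : 0 < d) (hT : ∀ i, (T i).det ≠ 0)
    (hρ : contractionRatio T < 1 / 2) :
    ∀ᵐ a : Fin m → Euc d, ∀ᵐ x ∂μ,
      lowerLocDim (projMeasure T a μ) (codingMap T a x) =
          ((min (Sloc T μ x) (d : ℝ≥0∞) : ℝ≥0∞) : EReal) ∧
        upperLocDim (projMeasure T a μ) (codingMap T a x) = Dloc T μ x := by
  have hρ1 : contractionRatio T < 1 := hρ.trans one_half_lt_one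
  filter_upwards [ae_ae_subexpLE_projBall_Gfun (μ := μ) hρ hT] with a ha
  filter_upwards [ha, ae_locDim_le hd hT hρ1 a] with x hx hle
  have hge := le_locDim_of_subexpLE hd hT hρ1 hx
  exact ⟨hle.1.antisymm hge.1, hle.2.antisymm hge.2⟩

variable (hρ : contractionRatio T < 1) (a : Fin m → Euc d)
include hρ

theorem lowerHausdorffDim_projMeasure : lowerHausdorffDim (projMeasure T a μ) =
    essInf (fun x => lowerLocDim (projMeasure T a μ) (codingMap T a x)) μ :=
  have := isProbabilityMeasure_projMeasure (μ := μ) hρ a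
  essInf_map_of_measurable (measurable_codingMap hρ a) (measurable_lowerLocDim _)

theorem upperHausdorffDim_projMeasure : upperHausdorffDim (projMeasure T a μ) =
    essSup (fun x => lowerLocDim (projMeasure T a μ) (codingMap T a x)) μ :=
  have := isProbabilityMeasure_projMeasure (μ := μ) hρ a
  essSup_map_measure (measurable_lowerLocDim _).aemeasurable
    (measurable_codingMap hρ a).aemeasurable

theorem lowerPackingDim_projMeasure : lowerPackingDim (projMeasure T a μ) =
    essInf (fun x => upperLocDim (projMeasure T a μ) (codingMap T a x)) μ :=
  have := isProbabilityMeasure_projMeasure (μ := μ) hρ a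
  essInf_map_of_measurable (measurable_codingMap hρ a) (measurable_upperLocDim _)

theorem upperPackingDim_projMeasure : upperPackingDim (projMeasure T a μ) =
    essSup (fun x => upperLocDim (projMeasure T a μ) (codingMap T a x)) μ :=
  have := isProbabilityMeasure_projMeasure (μ := μ) hρ a
  essSup_map_measure (measurable_upperLocDim _).aemeasurable
    (measurable_codingMap hρ a).aemeasurable

end Dimensions

theorem theorem1p1 (m d : ℕ) (hd : 0 < d) (T : Fin m → Matrix (Fin d) (Fin d) ℝ)
    (hT : ∀ i, (T i).det ≠ 0) (hT1 : ∀ i, opNorm (T i) < 1)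
    (μ : Measure (Shift m)) [IsProbabilityMeasure μ] :
    (∀ a : Fin m → Euc d,
      (∀ᵐ x ∂μ,
        lowerLocDim (projMeasure T a μ) (codingMap T a x) ≤
            ((min (Sloc T μ x) (d : ℝ≥0∞) : ℝ≥0∞) : EReal) ∧
        upperLocDim (projMeasure T a μ) (codingMap T a x) ≤ Dloc T μ x) ∧
      lowerHausdorffDim (projMeasure T a μ) ≤ ((min (Slower T μ) (d : ℝ≥0∞) : ℝ≥0∞) : EReal) ∧
      upperHausdorffDim (projMeasure T a μ) ≤ ((min (Supper T μ) (d : ℝ≥0∞) : ℝ≥0∞) : EReal) ∧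
      lowerPackingDim (projMeasure T a μ) ≤ Dlower T μ ∧
      upperPackingDim (projMeasure T a μ) ≤ Dupper T μ) ∧
    ((∀ i, opNorm (T i) < 1 / 2) →
      ∀ᵐ a : Fin m → Euc d ∂volume,
        (∀ᵐ x ∂μ,
          lowerLocDim (projMeasure T a μ) (codingMap T a x) =
              ((min (Sloc T μ x) (d : ℝ≥0∞) : ℝ≥0∞) : EReal) ∧
          upperLocDim (projMeasure T a μ) (codingMap T a x) = Dloc T μ x) ∧
        lowerHausdorffDim (projMeasure T a μ) = ((min (Slower T μ) (d : ℝ≥0∞) : ℝ≥0∞) : EReal) ∧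
        upperHausdorffDim (projMeasure T a μ) = ((min (Supper T μ) (d : ℝ≥0∞) : ℝ≥0∞) : EReal) ∧
        lowerPackingDim (projMeasure T a μ) = Dlower T μ ∧
        upperPackingDim (projMeasure T a μ) = Dupper T μ) := by
  have hρ : contractionRatio T < 1 := contractionRatio_lt one_pos hT1
  rw [Slower, Supper, ← essInf_coe_min, ← essSup_coe_min]
  refine ⟨fun a => ?_, fun hhalf => ?_⟩
  · rw [lowerHausdorffDim_projMeasure hρ, upperHausdorffDim_projMeasure hρ,
      lowerPackingDim_projMeasure hρ, upperPackingDim_projMeasure hρ]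
    have hle := ae_locDim_le (μ := μ) hd hT hρ a
    exact ⟨hle, essInf_mono_ae (hle.mono fun _ hx => hx.1),
      essSup_mono_ae (hle.mono fun _ hx => hx.1), essInf_mono_ae (hle.mono fun _ hx => hx.2),
      essSup_mono_ae (hle.mono fun _ hx => hx.2)⟩
  · filter_upwards [ae_ae_locDim_eq (μ := μ) hd hT (contractionRatio_lt one_half_pos hhalf)]
      with a heq
    rw [lowerHausdorffDim_projMeasure hρ, upperHausdorffDim_projMeasure hρ,
      lowerPackingDim_projMeasure hρ, upperPackingDim_projMeasure hρ]
    exact ⟨heq, essInf_congr_ae (heq.mono fun _ hx => hx.1),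
      essSup_congr_ae (heq.mono fun _ hx => hx.1), essInf_congr_ae (heq.mono fun _ hx => hx.2),
      essSup_congr_ae (heq.mono fun _ hx => hx.2)⟩
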